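/- A \emph{Halin graph} is a finite simple graph formed from a planar embedding of a tree with at least four vertices, none of degree two, by adding a cycle that connects the leaves of the tree in the cyclic order given by the embedding. A \emph{polytope} is the convex hull of a finite set of points in a Euclidean space; its \emph{graph} has its vertices ($0$-dimensional faces) as vertices and its edges ($1$-dimensional faces) as edges. A \emph{$3$-treetope} is a polytope $P$ of dimension $3$ that has a facet $B$ (the base) such that every face of $P$ that intersects $B$ in at most one point has dimension at most one. \textbf{Proposition.} Every Halin graph can be realized as a $3$-treetope: for every Halin graph $G$ there is a $3$-treetope $P\subset\mathbb{R}^3$ whose graph is isomorphic to $G$. -/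

import Mathlib

noncomputable section

namespace HalinTreetope

/-! ### Plane embeddings of graphs and Halin graphs -/

/-- A rotation system on a graph: a permutation of the darts (oriented edges) whose cycles are
exactly the sets of darts leaving a common vertex. It records, for every vertex, the cyclic
(say, counterclockwise) order of the edges around it. -/
structure RotationSystem {V : Type*} (G : SimpleGraph V) where
  /-- the next dart in the cyclic order around the same starting vertex -/
  rot : Equiv.Perm G.Dart
  sameCycle_iff : ∀ d e : G.Dart, rot.SameCycle d e ↔ d.fst = e.fst

namespace RotationSystem

variable {V : Type*} {G : SimpleGraph V}

/-- Face tracing: walk along the dart `d`, then leave its endpoint along the dart that follows the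
reversal of `d` in the rotation there. The cycles of this permutation are the boundary walks of
the faces of the embedding. -/
def facePerm (ρ : RotationSystem G) : Equiv.Perm G.Dart :=
  (Function.Involutive.toPerm SimpleGraph.Dart.symm SimpleGraph.Dart.symm_involutive).trans ρ.rot

/-- The number of faces of the embedding. -/
def numFaces (ρ : RotationSystem G) : ℕ :=
  Nat.card (Quotient (Equiv.Perm.SameCycle.setoid ρ.facePerm))

/-- A rotation system of a finite connected graph with at least one edge describes an embedding in
the plane (equivalently, the sphere) when Euler's formula `V + F = E + 2` holds. -/
def IsPlanar (ρ : RotationSystem G) : Prop :=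
  Nat.card V + ρ.numFaces = Nat.card G.edgeSet + 2

end RotationSystem

/-- A leaf is a vertex of degree one. -/
def IsLeaf {V : Type*} (T : SimpleGraph V) (v : V) : Prop :=
  (T.neighborSet v).ncard = 1

/-- `v` is the leaf that comes directly after the leaf `u` on a face boundary walk, that is, no
leaf is met strictly between them. A plane tree has a single face, whose boundary walk visits
every leaf once, so this is the cyclic order of the leaves given by the embedding. -/
def IsNextLeaf {V : Type*} {T : SimpleGraph V} (ρ : RotationSystem T) (u v : V) : Prop :=
  IsLeaf T u ∧ IsLeaf T v ∧
    ∃ (d : T.Dart) (n : ℕ), 0 < n ∧ d.fst = u ∧ ((ρ.facePerm ^ n) d).fst = v ∧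
      ∀ k, 0 < k → k < n → ¬ IsLeaf T ((ρ.facePerm ^ k) d).fst

/-- The cycle through the leaves of a plane tree, in the order given by the embedding. -/
def leafCycle {V : Type*} {T : SimpleGraph V} (ρ : RotationSystem T) : SimpleGraph V :=
  SimpleGraph.fromRel (IsNextLeaf ρ)

/-- A Halin graph: a plane tree with at least four vertices, none of them of degree two, together
with the cycle through its leaves in the order given by the embedding. -/
def IsHalin {V : Type*} (G : SimpleGraph V) : Prop :=
  4 ≤ Nat.card V ∧
    ∃ (T : SimpleGraph V) (ρ : RotationSystem T),
      T.IsTree ∧ (∀ v, (T.neighborSet v).ncard ≠ 2) ∧ ρ.IsPlanar ∧ G = T ⊔ leafCycle ρ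

/-! ### Polytopes, their graphs, and treetopes -/

variable {E : Type*} [NormedAddCommGroup E] [InnerProductSpace ℝ E]

/-- A polytope is the convex hull of a finite set of points. -/
def IsPolytope (P : Set E) : Prop :=
  ∃ S : Set E, S.Finite ∧ P = convexHull ℝ S

/-- The faces of a polytope: the empty set, the polytope itself, and its intersections with
supporting hyperplanes. -/
def IsFace (P F : Set E) : Prop :=
  IsExposed ℝ P F

open Classical in
/-- The affine dimension of a set, with value `-1` for the empty set. -/
def dim (F : Set E) : ℤ :=
  if F.Nonempty then (Module.finrank ℝ (vectorSpan ℝ F) : ℤ) else -1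

/-- A facet is a face of dimension one less than the polytope. -/
def IsFacet (P F : Set E) : Prop :=
  IsFace P F ∧ dim F = dim P - 1

/-- The type of vertices of a polytope: the points `x` such that `{x}` is a face. -/
abbrev Vertex (P : Set E) : Type _ :=
  {x : E // IsFace P {x}}

/-- The graph (1-skeleton) of a polytope: two distinct vertices are adjacent when they lie on a
common edge, that is, on a common face of dimension one. -/
def polytopeGraph (P : Set E) : SimpleGraph (Vertex P) where
  Adj x y := x ≠ y ∧ ∃ F : Set E, IsFace P F ∧ dim F = 1 ∧ (x : E) ∈ F ∧ (y : E) ∈ F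
  symm := ⟨fun _ _ h => ⟨h.1.symm, by
    obtain ⟨F, hF, hd, hx, hy⟩ := h.2
    exact ⟨F, hF, hd, hy, hx⟩⟩⟩
  loopless := ⟨fun _ h => h.1 rfl⟩

/-- A `k`-treetope: a polytope of dimension `k` with a facet `B` (the base) such that every face
that meets `B` in at most one point has dimension at most one. -/
def IsTreetope (k : ℕ) (P : Set E) : Prop :=
  IsPolytope P ∧ dim P = k ∧
    ∃ B : Set E, IsFacet P B ∧
      ∀ F : Set E, IsFace P F → (F ∩ B).Subsingleton → dim F ≤ 1

end HalinTreetope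

end

noncomputable section

namespace HalinTreetope

/-! ### Face walks of plane trees -/

section FaceWalk

variable {V : Type*} {T : SimpleGraph V} (ρ : RotationSystem T)

/-! A tree has one edge fewer than vertices, so Euler's formula leaves a single face, and the face
walk of the plane tree is one cycle through all darts. Between consecutive leaves this walk runs
through a gap, and `exists_gapLabelling` labels each dart by the gap on its side. The `n` leaves
give `n` gaps in cyclic order; at every interior vertex the labels of the outgoing darts are
distinct and appear in this order, and the branch beyond a dart `d` contains the gaps strictly
between `g d` and `g d.symm`.

The polytope has one facet for each gap `i`, with normal `mom i` on a conic, and a base with normal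
minus their sum. Three normals on the conic have a determinant whose sign is their cyclic order. An
edge of the tree must lie on the planes of its two gaps, so its direction is the cross product of
their normals. Along a dart the functional `mom i` then grows exactly when gap `i` is strictly
beyond the dart. Since a tree has no cycles, these directions can be prescribed freely
(`exists_potential`); the leaves are then pushed along their edges to a common base plane
(`exists_realization`).

Following paths in the tree, `mom i` is maximal exactly at the vertices incident to gap `i`
(`inner_eq_iff_hasGap`). Every functional maximal at a vertex is a nonnegative combination of three
normals of facets through it (`cone_interior`, `cone_leaf`). Hence a nonempty face is the whole
polytope, contains a facet, or lies in two facets (`FacetSystem.face_cases`). Two vertices share two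
gaps only along a tree edge, and a gap and the base only if they are consecutive leaves, so the
graph is the Halin graph. Every facet has two vertices on the base, which is the treetope property.
-/

theorem RotationSystem.rot_fst (d : T.Dart) : (ρ.rot d).fst = d.fst :=
  ((ρ.sameCycle_iff d (ρ.rot d)).1 (Equiv.Perm.sameCycle_apply_right.2 (Equiv.Perm.SameCycle.refl _ _))).symm

theorem RotationSystem.facePerm_apply (d : T.Dart) : ρ.facePerm d = ρ.rot d.symm := rfl

theorem RotationSystem.facePerm_fst (d : T.Dart) : (ρ.facePerm d).fst = d.snd := by
  rw [ρ.facePerm_apply, ρ.rot_fst]; rfl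

theorem IsLeaf.dart_eq {v : V} (hv : IsLeaf T v) {e f : T.Dart} (he : e.fst = v) (hf : f.fst = v) :
    e = f := by
  obtain ⟨w, hw⟩ := Set.ncard_eq_one.1 hv
  have h1 : e.snd ∈ T.neighborSet v := by have := e.adj; rw [he] at this; exact this
  have h2 : f.snd ∈ T.neighborSet v := by have := f.adj; rw [hf] at this; exact this
  rw [hw] at h1 h2
  exact SimpleGraph.Dart.ext _ _ (Prod.ext (he.trans hf.symm) (h1.trans h2.symm))

/-- The cycles of `rot` are full stars, so a fixed dart is alone at its vertex. -/
theorem RotationSystem.isLeaf_of_rot_eq {d : T.Dart} (h : ρ.rot d = d) : IsLeaf T d.fst := by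
  have : T.neighborSet d.fst = {d.snd} := by
    ext w
    constructor
    · intro hw
      let e : T.Dart := ⟨(d.fst, w), hw⟩
      have hs : ρ.rot.SameCycle d e := (ρ.sameCycle_iff d e).2 rfl
      have : d = e := hs.eq_of_left h
      rw [this]; rfl
    · rintro rfl; exact d.adj
  rw [IsLeaf, this, Set.ncard_singleton]

theorem ncard_pair_le (a b : V) : ({a, b} : Set V).ncard ≤ 2 := by
  simpa using Set.ncard_insert_le a {b}

instance finite_dart [Finite V] : Finite T.Dart :=
  Finite.of_injective _ SimpleGraph.Dart.toProd_injective

theorem exists_third_dart [Finite V] {v : V} (h1 : ¬ IsLeaf T v) (h2 : (T.neighborSet v).ncard ≠ 2)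
    {e f : T.Dart} (he : e.fst = v) :
    ∃ h : T.Dart, h.fst = v ∧ h ≠ e ∧ h ≠ f := by
  by_contra! hcon
  have hsub : T.neighborSet v ⊆ {e.snd, f.snd} := by
    intro w hw
    by_cases hwe : (⟨(v, w), hw⟩ : T.Dart) = e
    · rw [← hwe]; simp
    · have := hcon ⟨(v, w), hw⟩ rfl hwe
      rw [← this]; simp
  have hle : (T.neighborSet v).ncard ≤ 2 := (Set.ncard_le_ncard hsub).trans (ncard_pair_le _ _)
  have hne : (T.neighborSet v).ncard ≠ 0 := by
    rw [Ne, Set.ncard_eq_zero]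
    exact Set.Nonempty.ne_empty ⟨e.snd, by have := e.adj; rw [he] at this; exact this⟩
  unfold IsLeaf at h1
  omega

theorem RotationSystem.IsPlanar.sameCycle [Finite V] {ρ : RotationSystem T} (h : ρ.IsPlanar)
    (hT : T.IsTree) (d e : T.Dart) : ρ.facePerm.SameCycle d e := by
  classical
  have := Fintype.ofFinite V
  have h1 := hT.card_edgeFinset
  have h2 : ρ.numFaces = 1 := by
    unfold RotationSystem.IsPlanar at h
    rw [Nat.card_eq_fintype_card, Nat.card_eq_fintype_card, ← SimpleGraph.edgeFinset_card] at h
    omega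
  have := (Nat.card_eq_one_iff_unique.1 h2).1
  exact Quotient.exact (this.elim (Quotient.mk _ d) (Quotient.mk _ e))

variable [Finite V]

/-- The face walk of a plane tree that starts along `d` comes back along `d.symm`, without
visiting the starting vertex in between. -/
theorem exists_return (hT : T.IsAcyclic) (hs : ∀ d e : T.Dart, ρ.facePerm.SameCycle d e)
    (d : T.Dart) :
    ∃ k, 0 < k ∧ (ρ.facePerm ^ k) d = d.symm ∧
      ∀ j, 0 < j → j ≤ k → ((ρ.facePerm ^ j) d).fst ≠ d.fst := by
  classical
  have hex : ∃ k : ℕ, (ρ.facePerm ^ k) d = d.symm := (hs d d.symm).exists_nat_pow_eq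
  have hk := Nat.find_spec hex
  have hmin := fun m => Nat.find_min hex (m := m)
  set k := Nat.find hex
  have hk0 : 0 < k := by
    rcases Nat.eq_zero_or_pos k with h | h
    · rw [h] at hk
      exact absurd hk.symm d.symm_ne
    · exact h
  have hbr : ¬ (T.deleteEdges {s(d.fst, d.snd)}).Reachable d.fst d.snd := by
    have := (SimpleGraph.isAcyclic_iff_forall_isBridge.1 hT) d.edge_mem
    exact (SimpleGraph.isBridge_iff.1 this)
  -- The edge of `d` is a bridge, and by minimality of `k` the walk does not cross it back before;
  -- so it stays on the side of `d.snd`.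
  have key : ∀ j, 0 < j → j ≤ k →
      (T.deleteEdges {s(d.fst, d.snd)}).Reachable d.snd ((ρ.facePerm ^ j) d).fst := by
    intro j
    induction j with
    | zero => intro h; omega
    | succ j ih =>
      intro _ hj
      rw [pow_succ', Equiv.Perm.mul_apply, ρ.facePerm_fst]
      rcases Nat.eq_zero_or_pos j with rfl | hj0
      · exact SimpleGraph.Reachable.refl _
      · have hr := ih hj0 (by omega)
        refine hr.trans (SimpleGraph.Adj.reachable ?_)
        rw [SimpleGraph.deleteEdges_adj]
        refine ⟨SimpleGraph.Dart.adj _, fun hmem => ?_⟩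
        rw [Set.mem_singleton_iff, Sym2.eq_iff] at hmem
        rcases hmem with ⟨h1, _⟩ | ⟨h1, h2⟩
        · exact hbr (h1 ▸ hr).symm
        · exact hmin j (by omega) (SimpleGraph.Dart.ext _ _ (Prod.ext h1 h2))
  exact ⟨k, hk0, hk, fun j h0 hj he => hbr (he ▸ key j h0 hj).symm⟩

/-- If the endpoint of `d` is not a leaf, the next dart is not `d.symm`, and its own excursion is
nested in that of `d` and shorter. -/
theorem exists_leaf_of_return (hT : T.IsAcyclic) (hs : ∀ d e : T.Dart, ρ.facePerm.SameCycle d e)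
    (k : ℕ) (d : T.Dart) (hk : 0 < k) (hd : (ρ.facePerm ^ k) d = d.symm) :
    ∃ j, 0 < j ∧ j ≤ k ∧ IsLeaf T ((ρ.facePerm ^ j) d).fst := by
  induction k using Nat.strong_induction_on generalizing d with
  | _ k ih =>
  by_cases hl : IsLeaf T d.snd
  · exact ⟨1, one_pos, hk, by rwa [pow_one, ρ.facePerm_fst]⟩
  obtain ⟨k', hk', he, hno⟩ := exists_return ρ hT hs (ρ.facePerm d)
  have hk1 : (ρ.facePerm ^ (k - 1)) (ρ.facePerm d) = d.symm := by
    rw [← Equiv.Perm.mul_apply, ← pow_succ, Nat.sub_add_cancel hk, hd]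
  have h1 : 0 < k - 1 := by
    rcases Nat.eq_zero_or_pos (k - 1) with h | h
    · rw [h, pow_zero, Equiv.Perm.one_apply, ρ.facePerm_apply] at hk1
      exact absurd (ρ.isLeaf_of_rot_eq hk1) hl
    · exact h
  -- After `k - 1` steps the walk is back at the start of `ρ.facePerm d`, which `hno` forbids up to
  -- step `k'`.
  have h2 : k' < k - 1 := by
    by_contra! hcon
    refine hno (k - 1) h1 hcon ?_
    rw [hk1, ρ.facePerm_fst]; rfl
  obtain ⟨j, hj0, hj, hjl⟩ := ih k' (by omega) _ hk' he
  refine ⟨j + 1, by omega, by omega, ?_⟩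
  rwa [pow_succ, Equiv.Perm.mul_apply]

/-- An edge between two leaves would be a closed face walk of length two, and the tree would have
only two vertices. -/
theorem not_isLeaf_snd (hT : T.IsTree) (hs : ∀ d e : T.Dart, ρ.facePerm.SameCycle d e)
    (hV : 4 ≤ Nat.card V) {d : T.Dart} (hd : IsLeaf T d.fst) : ¬ IsLeaf T d.snd := by
  intro hd'
  have h1 : ρ.facePerm d = d.symm := hd'.dart_eq (ρ.facePerm_fst d) rfl
  have h2 : ρ.facePerm d.symm = d := hd.dart_eq (ρ.facePerm_fst d.symm) rfl
  have hall : ∀ n : ℕ, (ρ.facePerm ^ n) d = d ∨ (ρ.facePerm ^ n) d = d.symm := by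
    intro n
    induction n with
    | zero => exact Or.inl rfl
    | succ n ih =>
      rw [pow_succ', Equiv.Perm.mul_apply]
      rcases ih with h | h <;> rw [h]
      · exact Or.inr h1
      · exact Or.inl h2
  have huniv : (Set.univ : Set V) ⊆ {d.fst, d.snd} := by
    intro v _
    have : Nontrivial V := ⟨d.fst, d.snd, d.fst_ne_snd⟩
    obtain ⟨w, hw⟩ := hT.1.preconnected.exists_adj_of_nontrivial v
    obtain ⟨n, hn⟩ := (hs d ⟨(v, w), hw⟩).exists_nat_pow_eq
    rcases hall n with h | h <;> rw [hn] at h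
    · left; rw [← h]
    · right; exact (congrArg (fun e : T.Dart => e.fst) h)
  have := (Set.ncard_le_ncard huniv).trans (ncard_pair_le _ _)
  rw [Set.ncard_univ] at this
  omega

end FaceWalk

/-! ### Labelling the regions between consecutive leaves -/

/-- The strict cyclic order on the natural numbers. -/
def Cyc (a b c : ℕ) : Prop :=
  a < b ∧ b < c ∨ b < c ∧ c < a ∨ c < a ∧ a < b

/-- A labelling of the darts of a plane tree with `n` leaves by the numbers below `n`: the label of
a dart stands for the gap between two cyclically consecutive leaves that is on its side. -/
structure GapLabelling {V : Type*} (T : SimpleGraph V) (n : ℕ) (g : T.Dart → ℕ) : Prop where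
  three_le : 3 ≤ n
  lt : ∀ d, g d < n
  inj : ∀ e f : T.Dart, e.fst = f.fst → g e = g f → e = f
  not_cyc : ∀ e f : T.Dart, e.fst = f.fst → ¬ IsLeaf T e.fst → ¬ Cyc (g e) (g f) (g e.symm)
  exists_next : ∀ e : T.Dart, ¬ IsLeaf T e.fst → ∃ f : T.Dart, f.fst = e.fst ∧ g f = g e.symm
  symm_ne : ∀ e : T.Dart, g e ≠ g e.symm
  leaf : ∀ d : T.Dart, IsLeaf T d.fst → g d = g d.symm + 1 ∨ g d = 0 ∧ g d.symm + 1 = n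
  exists_leaf : ∀ i < n, ∃ d : T.Dart, IsLeaf T d.fst ∧ g d = i
  leaf_inj : ∀ d e : T.Dart, IsLeaf T d.fst → IsLeaf T e.fst → g d = g e → d = e
  leaf_snd : ∀ d : T.Dart, IsLeaf T d.fst → ¬ IsLeaf T d.snd
  third : ∀ e f : T.Dart, e.fst = f.fst → ¬ IsLeaf T e.fst →
    ∃ h : T.Dart, h.fst = e.fst ∧ h ≠ e ∧ h ≠ f

section Labelling

variable {V : Type*} [Finite V] {T : SimpleGraph V} (ρ : RotationSystem T)

open Classical in
theorem exists_gapLabelling (hT : T.IsTree) (hdeg : ∀ v, (T.neighborSet v).ncard ≠ 2)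
    (hV : 4 ≤ Nat.card V) (hs : ∀ d e : T.Dart, ρ.facePerm.SameCycle d e) :
    ∃ (n : ℕ) (g : T.Dart → ℕ), GapLabelling T n g ∧ ∀ u v, IsNextLeaf ρ u v ↔
      ∃ d e : T.Dart, IsLeaf T d.fst ∧ IsLeaf T e.fst ∧ d.fst = u ∧ e.fst = v ∧ g d = g e.symm := by
  have hnt : Nontrivial V := by
    rw [← Finite.one_lt_card_iff_nontrivial]; omega
  obtain ⟨d0, hd0⟩ : ∃ d : T.Dart, IsLeaf T d.fst := by
    obtain ⟨v⟩ := hT.1.nonempty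
    obtain ⟨w, hw⟩ := hT.1.preconnected.exists_adj_of_nontrivial v
    obtain ⟨k, hk, hk', _⟩ := exists_return ρ hT.2 hs ⟨(v, w), hw⟩
    obtain ⟨j, _, _, hj⟩ := exists_leaf_of_return ρ hT.2 hs k _ hk hk'
    exact ⟨_, hj⟩
  set f := ρ.facePerm with hf
  set N := Function.minimalPeriod f d0 with hN
  have hper : d0 ∈ Function.periodicPts f := by
    obtain ⟨k, hk, h⟩ := (isOfFinOrder_of_finite f).exists_pow_eq_one
    refine ⟨k, hk, ?_⟩
    rw [Function.IsPeriodicPt, Function.IsFixedPt, ← Equiv.Perm.coe_pow, h]; rfl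
  have hN0 : 0 < N := Function.minimalPeriod_pos_of_mem_periodicPts hper
  have hpos : ∀ d, ∃ k, k < N ∧ (f ^ k) d0 = d := by
    intro d
    obtain ⟨k, hk⟩ := (hs d0 d).exists_nat_pow_eq
    refine ⟨k % N, Nat.mod_lt _ hN0, ?_⟩
    rw [Equiv.Perm.coe_pow, Function.iterate_mod_minimalPeriod_eq, ← Equiv.Perm.coe_pow, hk]
  choose pos pos_lt pos_spec using hpos
  have pos_eq : ∀ k d, k < N → (f ^ k) d0 = d → pos d = k := by
    intro k d hk h
    have h2 := (pos_spec d).trans h.symm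
    rw [Equiv.Perm.coe_pow, Equiv.Perm.coe_pow] at h2
    exact Function.iterate_injOn_Iio_minimalPeriod (pos_lt d) hk h2
  have pos_add : ∀ k d, k ≤ N → pos ((f ^ k) d) = pos d + k ∧ pos d + k < N ∨
      pos ((f ^ k) d) + N = pos d + k := by
    intro k d hk
    have hd := pos_lt d
    have h1 : (f ^ (pos d + k)) d0 = (f ^ k) d := by
      rw [add_comm, pow_add, Equiv.Perm.mul_apply, pos_spec]
    by_cases h : pos d + k < N
    · exact Or.inl ⟨pos_eq _ _ h h1, h⟩
    · right
      have : pos ((f ^ k) d) = pos d + k - N := by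
        refine pos_eq _ _ (by omega) ?_
        rw [← h1]
        conv_rhs => rw [show pos d + k = (pos d + k - N) + N by omega, pow_add,
          Equiv.Perm.mul_apply]
        congr 1
        rw [Equiv.Perm.coe_pow, Function.iterate_minimalPeriod]
      omega
  have pos_inj : ∀ d e, pos d = pos e → d = e := by
    intro d e h
    rw [← pos_spec d, ← pos_spec e, h]
  have pos_d0 : pos d0 = 0 := pos_eq 0 d0 hN0 rfl
  -- The shift by one makes `lab k` count the leaves at positions `1` to `k`: the starting leaf is
  -- not counted and opens gap `0`.
  let p : ℕ → Prop := fun s => IsLeaf T ((f ^ (s + 1)) d0).fst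
  let lab : ℕ → ℕ := fun k => Nat.count p k
  have lab_mono : Monotone lab := Nat.count_monotone p
  have lab_lt : ∀ j k, p j → j < k → lab j < lab k := fun j k hj hjk => Nat.count_strict_mono hj hjk
  have p_pos : ∀ d, 0 < pos d → (p (pos d - 1) ↔ IsLeaf T d.fst) := by
    intro d hd
    change IsLeaf T ((f ^ (pos d - 1 + 1)) d0).fst ↔ _
    rw [Nat.sub_add_cancel hd, pos_spec]
  have pos_pos : ∀ d, ¬ IsLeaf T d.fst → 0 < pos d := by
    intro d hd
    by_contra! h
    have : d = d0 := pos_inj _ _ (by omega)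
    exact hd (this ▸ hd0)
  -- The number of leaves: those counted by `lab`, and the starting one.
  set n := lab (N - 1) + 1 with hn
  let g : T.Dart → ℕ := fun d => lab (pos d)
  have g_lt : ∀ d, g d < n := by
    intro d
    have : lab (pos d) ≤ lab (N - 1) := lab_mono (by have := pos_lt d; omega)
    change lab (pos d) < n
    omega
  have g_step : ∀ d, ¬ IsLeaf T (f d).fst → g (f d) = g d := by
    intro d hd
    have h0 := pos_pos _ hd
    have hd' := pos_lt d
    have h1 : pos (f d) = pos d + 1 := by
      have := pos_add 1 d hN0
      rw [pow_one] at this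
      omega
    have h2 : ¬ p (pos d) := by
      have := p_pos _ h0
      rw [h1, Nat.add_sub_cancel] at this
      rwa [this]
    change Nat.count p (pos (f d)) = Nat.count p (pos d)
    rw [h1, Nat.count_succ_eq_count_iff]
    exact h2
  have g_leaf : ∀ d, IsLeaf T (f d).fst → g (f d) = g d + 1 ∨ g (f d) = 0 ∧ g d + 1 = n := by
    intro d hd
    have := pos_add 1 d hN0
    rw [pow_one] at this
    have hd' := pos_lt d
    rcases this with ⟨h1, _⟩ | h1
    · left
      change Nat.count p (pos (f d)) = Nat.count p (pos d) + 1
      rw [h1, Nat.count_succ_eq_succ_count_iff]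
      have := p_pos (f d) (by omega)
      rw [h1, Nat.add_sub_cancel] at this
      exact this.2 hd
    · right
      have h2 : pos (f d) = 0 := by omega
      have h3 : pos d = N - 1 := by omega
      refine ⟨?_, ?_⟩
      · change Nat.count p (pos (f d)) = 0
        rw [h2, Nat.count_zero]
      · change lab (pos d) + 1 = n
        rw [h3]
  have f_symm : ∀ d : T.Dart, f d.symm = ρ.rot d := fun d => by
    rw [hf, ρ.facePerm_apply, SimpleGraph.Dart.symm_symm]
  have g_symm : ∀ d : T.Dart, ¬ IsLeaf T d.fst → g (ρ.rot d) = g d.symm := by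
    intro d hd
    rw [← f_symm]
    refine g_step _ ?_
    rwa [f_symm, ρ.rot_fst]
  -- the arc of the face walk from a dart to the next dart around its start
  have arc : ∀ d : T.Dart, ∃ k, k < N ∧ 0 < k ∧ (f ^ (k + 1)) d = ρ.rot d ∧
      (∀ j, 0 < j → j ≤ k → ((f ^ j) d).fst ≠ d.fst) ∧
      ∃ j, 0 < j ∧ j ≤ k ∧ IsLeaf T ((f ^ j) d).fst := by
    intro d
    obtain ⟨k, hk0, hk, hno⟩ := exists_return ρ hT.2 hs d
    refine ⟨k, ?_, hk0, ?_, hno, exists_leaf_of_return ρ hT.2 hs k d hk0 hk⟩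
    · by_contra! h
      refine hno N hN0 h ?_
      have : (f ^ N) d = d := by
        apply pos_inj
        have := pos_add N d le_rfl
        omega
      rw [← hf, this]
    · rw [pow_succ', Equiv.Perm.mul_apply, hk, f_symm]
  -- Either the arc from `d` to `ρ.rot d` does not pass position `0`, and the leaf on it raises the
  -- label, or it wraps around, and `d` and `ρ.rot d` are the last and first darts at their vertex.
  have arc_pos : ∀ d : T.Dart, ¬ IsLeaf T d.fst →
      (pos d < pos (ρ.rot d) ∧ g d < g (ρ.rot d) ∧
        ∀ e : T.Dart, e.fst = d.fst → pos e ≤ pos d ∨ pos (ρ.rot d) ≤ pos e) ∨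
      (pos (ρ.rot d) ≤ pos d ∧
        ∀ e : T.Dart, e.fst = d.fst → pos (ρ.rot d) ≤ pos e ∧ pos e ≤ pos d) := by
    intro d hd
    obtain ⟨k, hkN, hk0, hk, hno, j, hj0, hj, hjl⟩ := arc d
    have h1 := pos_add (k + 1) d hkN
    rw [hk] at h1
    have hout : ∀ e : T.Dart, e.fst = d.fst → ∀ j, 0 < j → j ≤ k → pos e ≠ pos ((f ^ j) d) := by
      intro e he j h0 h1 h2
      exact hno j h0 h1 (by rw [← pos_inj _ _ h2, he])
    rcases h1 with ⟨h1, h2⟩ | h1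
    · left
      refine ⟨by omega, ?_, ?_⟩
      · have h3 := pos_add j d (by omega)
        have h4 : pos ((f ^ j) d) = pos d + j := by omega
        have h5 := (p_pos ((f ^ j) d) (by omega)).2 hjl
        rw [h4] at h5
        calc lab (pos d) ≤ lab (pos d + j - 1) := lab_mono (by omega)
          _ < lab (pos (ρ.rot d)) := lab_lt _ _ h5 (by omega)
      · intro e he
        by_contra! hcon
        have h3 := pos_add (pos e - pos d) d (by omega)
        exact hout e he (pos e - pos d) (by omega) (by omega) (by omega)
    · right
      refine ⟨by omega, fun e he => ?_⟩
      by_contra! hcon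
      have hd' := pos_lt d
      have he' := pos_lt e
      by_cases hlt : pos e ≤ pos d
      · have h3 := pos_add (pos e + N - pos d) d (by omega)
        exact hout e he (pos e + N - pos d) (by omega) (by omega) (by omega)
      · have h3 := pos_add (pos e - pos d) d (by omega)
        exact hout e he (pos e - pos d) (by omega) (by omega) (by omega)
  have g_mono : ∀ d e, pos d ≤ pos e → g d ≤ g e := fun d e h => lab_mono h
  have g_inj : ∀ e f : T.Dart, e.fst = f.fst → g e = g f → e = f := by
    have key : ∀ e f : T.Dart, e.fst = f.fst → pos e < pos f → g e ≠ g f := by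
      intro e e' he hlt
      by_cases hl : IsLeaf T e.fst
      · have := hl.dart_eq rfl he.symm
        rw [this] at hlt
        exact absurd hlt (lt_irrefl _)
      rcases arc_pos e hl with ⟨_, h2, h3⟩ | ⟨_, h2⟩
      · rcases h3 e' he.symm with h | h
        · omega
        · have := g_mono _ _ h
          omega
      · have := h2 e' he.symm
        omega
    intro e e' he h
    by_contra hne
    have : pos e ≠ pos e' := fun h => hne (pos_inj _ _ h)
    rcases lt_or_gt_of_ne this with h1 | h1
    · exact key e e' he h1 h
    · exact key e' e he.symm h1 h.symm
  have third : ∀ e f : T.Dart, e.fst = f.fst → ¬ IsLeaf T e.fst →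
      ∃ h : T.Dart, h.fst = e.fst ∧ h ≠ e ∧ h ≠ f := fun e f _ hl =>
    exists_third_dart hl (hdeg _) rfl
  have leaf_snd : ∀ d : T.Dart, IsLeaf T d.fst → ¬ IsLeaf T d.snd := fun d hd =>
    not_isLeaf_snd ρ hT hs hV hd
  have three_le : 3 ≤ n := by
    obtain ⟨h, h1, h2, _⟩ := third d0.symm d0.symm rfl (leaf_snd d0 hd0)
    obtain ⟨h', h1', h2', h3'⟩ := third d0.symm h h1.symm (leaf_snd d0 hd0)
    have e1 : g h ≠ g d0.symm := fun hh => h2 (g_inj _ _ h1 hh)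
    have e2 : g h' ≠ g d0.symm := fun hh => h2' (g_inj _ _ h1' hh)
    have e3 : g h' ≠ g h := fun hh => h3' (g_inj _ _ (h1'.trans h1.symm) hh)
    have := g_lt h
    have := g_lt h'
    have := g_lt d0.symm
    omega
  have leaf : ∀ d : T.Dart, IsLeaf T d.fst → g d = g d.symm + 1 ∨ g d = 0 ∧ g d.symm + 1 = n := by
    intro d hd
    have : f d.symm = d := hd.dart_eq (by rw [hf, ρ.facePerm_fst]; rfl) rfl
    have h := g_leaf d.symm (by rwa [this])
    rwa [this] at h
  have leaf_inj : ∀ d e : T.Dart, IsLeaf T d.fst → IsLeaf T e.fst → g d = g e → d = e := by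
    have key : ∀ d e, IsLeaf T e.fst → pos d < pos e → g d ≠ g e := by
      intro d e he hlt
      have h1 := (p_pos e (by omega)).2 he
      have h2 : lab (pos d) ≤ lab (pos e - 1) := lab_mono (by omega)
      have h3 : lab (pos e - 1) < lab (pos e) := lab_lt _ _ h1 (by omega)
      change lab (pos d) ≠ lab (pos e)
      omega
    intro d e hd he h
    apply pos_inj
    by_contra hne
    rcases lt_or_gt_of_ne hne with h1 | h1
    · exact key d e he h1 h
    · exact key e d hd h1 h.symm
  have exists_leaf : ∀ i < n, ∃ d : T.Dart, IsLeaf T d.fst ∧ g d = i := by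
    intro i hi
    rcases Nat.eq_zero_or_pos i with rfl | hi0
    · refine ⟨d0, hd0, ?_⟩
      change Nat.count p (pos d0) = 0
      rw [pos_d0, Nat.count_zero]
    -- The count rises by at most one at a time, so the first position where it reaches `i` is at a
    -- leaf and has label exactly `i`.
    have hex : ∃ k, i ≤ lab k := ⟨N - 1, by omega⟩
    have h1 := Nat.find_spec hex
    have h2 := fun m => Nat.find_min hex (m := m)
    have h3 : Nat.find hex ≤ N - 1 := Nat.find_min' hex (by omega)
    set k := Nat.find hex
    have hk0 : 0 < k := by
      by_contra! h
      have : lab k = 0 := by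
        rw [Nat.le_zero.1 h]; exact Nat.count_zero p
      omega
    have h4 := h2 (k - 1) (by omega)
    have h5 : lab k = lab (k - 1) + if p (k - 1) then 1 else 0 := by
      have := Nat.count_succ p (k - 1)
      rwa [Nat.sub_add_cancel hk0] at this
    have h6 : p (k - 1) := by
      by_contra h
      rw [if_neg h] at h5
      omega
    rw [if_pos h6] at h5
    refine ⟨(f ^ k) d0, ?_, ?_⟩
    · have : IsLeaf T ((f ^ (k - 1 + 1)) d0).fst := h6
      rwa [Nat.sub_add_cancel hk0] at this
    · change lab (pos ((f ^ k) d0)) = i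
      rw [pos_eq k _ (by omega) rfl]
      omega
  refine ⟨n, g, ⟨three_le, g_lt, g_inj, ?_, ?_, ?_, leaf, exists_leaf, leaf_inj, leaf_snd, third⟩, ?_⟩
  · intro e e' he hl
    rw [← g_symm e hl]
    unfold Cyc
    rcases arc_pos e hl with ⟨h1, h2, h3⟩ | ⟨h1, h2⟩
    · rcases h3 e' he.symm with h | h
      · have := g_mono _ _ h
        omega
      · have := g_mono _ _ h
        omega
    · have h3 := g_mono _ _ (h2 e' he.symm).1
      have h4 := g_mono _ _ (h2 e' he.symm).2
      omega
  · intro e hl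
    exact ⟨ρ.rot e, ρ.rot_fst e, g_symm e hl⟩
  · intro e he
    by_cases hl : IsLeaf T e.fst
    · have := leaf e hl
      have := three_le
      omega
    · rw [← g_symm e hl] at he
      exact hl (ρ.isLeaf_of_rot_eq (g_inj _ _ (ρ.rot_fst e) he.symm))
  · intro u v
    constructor
    · rintro ⟨hu, hv, d, m, hm, rfl, rfl, hno⟩
      refine ⟨d, (f ^ m) d, hu, hv, rfl, rfl, ?_⟩
      -- The label is constant until the next leaf is met.
      have h1 : ∀ k, k < m → g ((f ^ k) d) = g d := by
        intro k
        induction k with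
        | zero => intro _; rfl
        | succ k ih =>
          intro hk
          rw [← ih (by omega), pow_succ', Equiv.Perm.mul_apply]
          refine g_step _ ?_
          have := hno (k + 1) (by omega) hk
          rwa [pow_succ', Equiv.Perm.mul_apply] at this
      have h2 : f ((f ^ m) d).symm = (f ^ m) d :=
        hv.dart_eq (by rw [hf, ρ.facePerm_fst]; rfl) rfl
      have h3 : ((f ^ m) d).symm = (f ^ (m - 1)) d := by
        apply f.injective
        rw [h2, ← Equiv.Perm.mul_apply, ← pow_succ', Nat.sub_add_cancel hm]
      rw [h3, h1 _ (by omega)]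
    · rintro ⟨d, e, hu, hv, rfl, rfl, hg⟩
      have hfe : f e.symm = e := hv.dart_eq (by rw [hf, ρ.facePerm_fst]; rfl) rfl
      have hle : pos d ≤ pos e.symm := by
        by_contra! hlt
        have h1 := (p_pos d (by omega)).2 hu
        have h2 : lab (pos e.symm) ≤ lab (pos d - 1) := lab_mono (by omega)
        have h3 : lab (pos d - 1) < lab (pos d) := lab_lt _ _ h1 (by omega)
        change lab (pos d) = lab (pos e.symm) at hg
        omega
      have hes := pos_lt e.symm
      have hpow : (f ^ (pos e.symm - pos d)) d = e.symm := by
        apply pos_inj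
        have := pos_add (pos e.symm - pos d) d (by omega)
        omega
      refine ⟨hu, hv, d, pos e.symm - pos d + 1, by omega, rfl, ?_, ?_⟩
      · rw [← hf, pow_succ', Equiv.Perm.mul_apply, hpow, hfe]
      · intro k hk0 hk hl
        have h1 := pos_add k d (by omega)
        have h2 : pos ((f ^ k) d) = pos d + k := by omega
        have h3 := (p_pos ((f ^ k) d) (by omega)).2 hl
        have h4 : lab (pos d) ≤ lab (pos ((f ^ k) d) - 1) := lab_mono (by omega)
        have h5 : lab (pos ((f ^ k) d) - 1) < lab (pos ((f ^ k) d)) := lab_lt _ _ h3 (by omega)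
        have h6 : lab (pos ((f ^ k) d)) ≤ lab (pos e.symm) := lab_mono (by omega)
        change lab (pos d) = lab (pos e.symm) at hg
        omega

end Labelling

/-! ### Polytopes given by points and supporting normals -/

section Dimension

variable {E : Type*} [NormedAddCommGroup E] [InnerProductSpace ℝ E]

open scoped RealInnerProductSpace

theorem dim_eq_finrank {F : Set E} (h : F.Nonempty) :
    dim F = (Module.finrank ℝ (vectorSpan ℝ F) : ℤ) := if_pos h

theorem le_dim [FiniteDimensional ℝ E] {k : ℕ} {F : Set E} (h : F.Nonempty) (w : Fin k → E)
    (hw : LinearIndependent ℝ w) (hF : ∀ i, w i ∈ vectorSpan ℝ F) : (k : ℤ) ≤ dim F := by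
  rw [dim_eq_finrank h, Nat.cast_le, ← Fintype.card_fin k, ← finrank_span_eq_card hw]
  refine Submodule.finrank_mono (Submodule.span_le.2 ?_)
  rintro _ ⟨i, rfl⟩
  exact hF i

/-- All differences of points of `F` lie in the orthogonal complement of the span of `w`. The bound
on `k` serves the empty set, of dimension `-1`. -/
theorem dim_add_le [FiniteDimensional ℝ E] {k : ℕ} {F : Set E} (w : Fin k → E)
    (hw : LinearIndependent ℝ w) (hk : k ≤ Module.finrank ℝ E)
    (hF : ∀ y ∈ F, ∀ z ∈ F, ∀ i, ⟪w i, y⟫ = ⟪w i, z⟫) :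
    dim F + k ≤ Module.finrank ℝ E := by
  by_cases h : F.Nonempty
  · rw [dim_eq_finrank h]
    have h1 : vectorSpan ℝ F ≤ (Submodule.span ℝ (Set.range w))ᗮ := by
      refine Submodule.span_le.2 ?_
      rintro _ ⟨y, hy, z, hz, rfl⟩
      rw [SetLike.mem_coe, Submodule.mem_orthogonal]
      intro u hu
      induction hu using Submodule.span_induction with
      | mem u hu =>
        obtain ⟨i, rfl⟩ := hu
        change ⟪w i, y - z⟫ = 0
        rw [inner_sub_right, hF y hy z hz i, sub_self]
      | zero => exact inner_zero_left _
      | add a b _ _ ha hb => rw [inner_add_left, ha, hb, add_zero]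
      | smul t a _ ha => rw [real_inner_smul_left, ha, mul_zero]
    have h2 := Submodule.finrank_mono h1
    have h3 := Submodule.finrank_add_finrank_orthogonal (Submodule.span ℝ (Set.range w))
    have h4 := finrank_span_eq_card hw
    rw [Fintype.card_fin] at h4
    omega
  · rw [dim, if_neg h]
    omega

theorem one_le_dim [FiniteDimensional ℝ E] {F : Set E} {p q : E} (hp : p ∈ F) (hq : q ∈ F)
    (h : p ≠ q) : 1 ≤ dim F := by
  have := le_dim ⟨p, hp⟩ ![p - q] (by simpa using sub_ne_zero.2 h)
    (by simpa using vsub_mem_vectorSpan ℝ hp hq)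
  simpa using this

theorem two_le_dim [FiniteDimensional ℝ E] {F : Set E} {p q r N : E} (hp : p ∈ F) (hq : q ∈ F)
    (hr : r ∈ F) (h : p ≠ q) (h1 : ⟪N, p⟫ = ⟪N, q⟫) (h2 : ⟪N, r⟫ ≠ ⟪N, q⟫) : 2 ≤ dim F := by
  have hi : LinearIndependent ℝ ![p - q, r - q] := by
    rw [LinearIndependent.pair_iff]
    intro s t hst
    have h3 : t = 0 := by
      have := congrArg (fun y => ⟪N, y⟫) hst
      simp only [inner_add_right, real_inner_smul_right, inner_sub_right, h1, inner_zero_right] at this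
      have : t * (⟪N, r⟫ - ⟪N, q⟫) = 0 := by linarith
      exact (mul_eq_zero.1 this).resolve_right (sub_ne_zero.2 h2)
    subst h3
    rw [zero_smul, add_zero, smul_eq_zero] at hst
    exact ⟨hst.resolve_right (sub_ne_zero.2 h), rfl⟩
  have := le_dim ⟨p, hp⟩ _ hi (by
    intro i; fin_cases i
    · exact vsub_mem_vectorSpan ℝ hp hq
    · exact vsub_mem_vectorSpan ℝ hr hq)
  exact_mod_cast this

/-- The three differences from `q` are triangular with respect to `M` and `N`: `M` detects only the
third, and `N` separates the second from the first. -/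
theorem three_le_dim [FiniteDimensional ℝ E] {F : Set E} {p q r s N M : E} (hp : p ∈ F)
    (hq : q ∈ F) (hr : r ∈ F) (hs : s ∈ F) (h : p ≠ q) (h1 : ⟪N, p⟫ = ⟪N, q⟫)
    (h2 : ⟪N, r⟫ ≠ ⟪N, q⟫) (h3 : ⟪M, p⟫ = ⟪M, q⟫) (h4 : ⟪M, r⟫ = ⟪M, q⟫) (h5 : ⟪M, s⟫ ≠ ⟪M, q⟫) :
    3 ≤ dim F := by
  have hi : LinearIndependent ℝ ![p - q, r - q, s - q] := by
    rw [Fintype.linearIndependent_iff]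
    intro g hg
    rw [Fin.sum_univ_three] at hg
    simp only [Matrix.cons_val] at hg
    have e2 : g 2 = 0 := by
      have := congrArg (fun y => ⟪M, y⟫) hg
      simp only [inner_add_right, real_inner_smul_right, inner_sub_right, h3, h4,
        inner_zero_right] at this
      have : g 2 * (⟪M, s⟫ - ⟪M, q⟫) = 0 := by linarith
      exact (mul_eq_zero.1 this).resolve_right (sub_ne_zero.2 h5)
    rw [e2, zero_smul, add_zero] at hg
    have e1 : g 1 = 0 := by
      have := congrArg (fun y => ⟪N, y⟫) hg
      simp only [inner_add_right, real_inner_smul_right, inner_sub_right, h1,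
        inner_zero_right] at this
      have : g 1 * (⟪N, r⟫ - ⟪N, q⟫) = 0 := by linarith
      exact (mul_eq_zero.1 this).resolve_right (sub_ne_zero.2 h2)
    rw [e1, zero_smul, add_zero, smul_eq_zero] at hg
    have e0 := hg.resolve_right (sub_ne_zero.2 h)
    intro i
    fin_cases i
    exacts [e0, e1, e2]
  have := le_dim ⟨p, hp⟩ _ hi (by
    intro i; fin_cases i
    · exact vsub_mem_vectorSpan ℝ hp hq
    · exact vsub_mem_vectorSpan ℝ hr hq
    · exact vsub_mem_vectorSpan ℝ hs hq)
  exact_mod_cast this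

end Dimension

/-! ### Faces of a polytope with known facet normals -/

section FacetSystem

variable {E : Type*} [NormedAddCommGroup E] [InnerProductSpace ℝ E]

open scoped RealInnerProductSpace

/-- Points `x v` and outer normals `N i` with support numbers `c i`, such that the facets given by
the normals form a treetope with base `b` whose graph is `G`. -/
structure FacetSystem {V ι : Type*} (G : SimpleGraph V) (x : V → E) (N : ι → E) (c : ι → ℝ)
    (b : ι) : Prop where
  le : ∀ i v, ⟪N i, x v⟫ ≤ c i
  injective : Function.Injective x
  cone : ∀ u Q, (∀ v, ⟪Q, x v⟫ ≤ ⟪Q, x u⟫) → ∃ i j k, i ≠ j ∧ i ≠ k ∧ j ≠ k ∧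
    ⟪N i, x u⟫ = c i ∧ ⟪N j, x u⟫ = c j ∧ ⟪N k, x u⟫ = c k ∧
    ∃ r s t : ℝ, 0 ≤ r ∧ 0 ≤ s ∧ 0 ≤ t ∧ Q = r • N i + s • N j + t • N k
  indep : ∀ i j, i ≠ j → LinearIndependent ℝ ![N i, N j]
  vertex : ∀ u, ∃ i j k, ⟪N i, x u⟫ = c i ∧ ⟪N j, x u⟫ = c j ∧ ⟪N k, x u⟫ = c k ∧
    ∀ y, ⟪N i, y⟫ = 0 → ⟪N j, y⟫ = 0 → ⟪N k, y⟫ = 0 → y = 0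
  adj : ∀ u v, u ≠ v → (G.Adj u v ↔ ∃ i j, i ≠ j ∧ ⟪N i, x u⟫ = c i ∧ ⟪N i, x v⟫ = c i ∧
    ⟪N j, x u⟫ = c j ∧ ⟪N j, x v⟫ = c j)
  side : ∀ i, i ≠ b → ∃ u v w, u ≠ v ∧ ⟪N i, x u⟫ = c i ∧ ⟪N i, x v⟫ = c i ∧ ⟪N i, x w⟫ = c i ∧
    ⟪N b, x u⟫ = c b ∧ ⟪N b, x v⟫ = c b ∧ ⟪N b, x w⟫ ≠ c b
  base : ∃ u v w z i, u ≠ v ∧ ⟪N b, x u⟫ = c b ∧ ⟪N b, x v⟫ = c b ∧ ⟪N b, x w⟫ = c b ∧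
    ⟪N b, x z⟫ ≠ c b ∧ ⟪N i, x u⟫ = c i ∧ ⟪N i, x v⟫ = c i ∧ ⟪N i, x w⟫ ≠ c i

namespace FacetSystem

variable {V ι : Type*} {G : SimpleGraph V} {x : V → E} {N : ι → E} {c : ι → ℝ} {b : ι}

theorem inner_le_of_mem_convexHull {Q : E} {m : ℝ} (h : ∀ v, ⟪Q, x v⟫ ≤ m) {y : E}
    (hy : y ∈ convexHull ℝ (Set.range x)) : ⟪Q, y⟫ ≤ m := by
  have hc : Convex ℝ {y | ⟪Q, y⟫ ≤ m} := convex_halfSpace_le (innerSL ℝ Q).isLinear m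
  exact convexHull_min (by rintro _ ⟨v, rfl⟩; exact h v) hc hy

theorem mem_hull (v : V) : x v ∈ convexHull ℝ (Set.range x) :=
  subset_convexHull ℝ _ ⟨v, rfl⟩

/-- The maximum of a sum of supporting functionals, when attained, defines the intersection of
their faces. -/
theorem isFace_of_eq {P : Set E} {Q y₀ : E} (h0 : y₀ ∈ P) (h : ∀ y ∈ P, ⟪Q, y⟫ ≤ ⟪Q, y₀⟫) :
    IsFace P {y ∈ P | ⟪Q, y⟫ = ⟪Q, y₀⟫} := by
  intro _
  refine ⟨innerSL ℝ Q, ?_⟩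
  ext y
  simp only [Set.mem_ofPred_eq, innerSL_apply_apply]
  constructor
  · rintro ⟨hy, he⟩
    exact ⟨hy, fun z hz => he ▸ h z hz⟩
  · rintro ⟨hy, he⟩
    exact ⟨hy, le_antisymm (h y hy) (he y₀ h0)⟩

variable (S : FacetSystem G x N c b)
include S

theorem le_hull (i : ι) {y : E} (hy : y ∈ convexHull ℝ (Set.range x)) : ⟪N i, y⟫ ≤ c i :=
  inner_le_of_mem_convexHull (S.le i) hy

/-- The sum of two supporting functionals reaches the sum of their bounds only where both are tight.
-/
theorem isFace_pair {i j : ι} {u : V} (hi : ⟪N i, x u⟫ = c i) (hj : ⟪N j, x u⟫ = c j) :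
    IsFace (convexHull ℝ (Set.range x))
      {y ∈ convexHull ℝ (Set.range x) | ⟪N i, y⟫ = c i ∧ ⟪N j, y⟫ = c j} := by
  convert isFace_of_eq (Q := N i + N j) (mem_hull (x := x) u) ?_ using 1
  · ext y
    simp only [Set.mem_ofPred_eq, inner_add_left, hi, hj]
    refine and_congr_right fun hy => ?_
    have h1 := S.le_hull i hy
    have h2 := S.le_hull j hy
    constructor
    · rintro ⟨h3, h4⟩; rw [h3, h4]
    · intro h; constructor <;> linarith
  · intro y hy
    rw [inner_add_left, inner_add_left, hi, hj]
    exact add_le_add (S.le_hull i hy) (S.le_hull j hy)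

theorem isFace_single {i : ι} {u : V} (hi : ⟪N i, x u⟫ = c i) :
    IsFace (convexHull ℝ (Set.range x)) {y ∈ convexHull ℝ (Set.range x) | ⟪N i, y⟫ = c i} := by
  simpa using S.isFace_pair hi hi

theorem isFace_vertex (u : V) : IsFace (convexHull ℝ (Set.range x)) {x u} := by
  obtain ⟨i, j, k, hi, hj, hk, h⟩ := S.vertex u
  convert isFace_of_eq (Q := N i + N j + N k) (mem_hull (x := x) u) ?_ using 1
  · ext y
    simp only [Set.mem_ofPred_eq, inner_add_left, hi, hj, hk, Set.mem_singleton_iff]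
    constructor
    · rintro rfl; exact ⟨mem_hull u, by rw [hi, hj, hk]⟩
    · rintro ⟨hy, he⟩
      have h1 := S.le_hull i hy
      have h2 := S.le_hull j hy
      have h3 := S.le_hull k hy
      rw [← sub_eq_zero]
      apply h <;> rw [inner_sub_right] <;> linarith
  · intro y hy
    simp only [inner_add_left, hi, hj, hk]
    have h1 := S.le_hull i hy
    have h2 := S.le_hull j hy
    have h3 := S.le_hull k hy
    linarith

/-- A nonempty proper face is either the facet of one normal, or lies in two facets. -/
theorem face_cases [FiniteDimensional ℝ E] [Finite V] {F : Set E}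
    (hF : IsFace (convexHull ℝ (Set.range x)) F) (hne : F.Nonempty) :
    F = convexHull ℝ (Set.range x) ∨
    (∃ i, ∀ y ∈ convexHull ℝ (Set.range x), ⟪N i, y⟫ = c i → y ∈ F) ∨
    (∃ i j, i ≠ j ∧ ∀ y ∈ F, ⟪N i, y⟫ = c i ∧ ⟪N j, y⟫ = c j) := by
  obtain ⟨l, hl⟩ := hF hne
  obtain ⟨Q, rfl⟩ := (InnerProductSpace.toDual ℝ E).surjective l
  simp only [InnerProductSpace.toDual_apply_apply] at hl
  have : Nonempty V := by
    obtain ⟨u, _⟩ := S.base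
    exact ⟨u⟩
  obtain ⟨u, hu⟩ := Finite.exists_max (fun v => ⟪Q, x v⟫)
  have hmax : ∀ y ∈ convexHull ℝ (Set.range x), ⟪Q, y⟫ ≤ ⟪Q, x u⟫ := fun y hy =>
    inner_le_of_mem_convexHull hu hy
  have hmem : ∀ y, y ∈ F ↔ y ∈ convexHull ℝ (Set.range x) ∧ ⟪Q, y⟫ = ⟪Q, x u⟫ := by
    intro y
    rw [hl]
    constructor
    · rintro ⟨hy, he⟩
      exact ⟨hy, le_antisymm (hmax y hy) (he _ (mem_hull u))⟩
    · rintro ⟨hy, he⟩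
      exact ⟨hy, fun z hz => he ▸ hmax z hz⟩
  obtain ⟨i, j, k, hij, hik, hjk, hi, hj, hk, r, s, t, hr, hs, ht, hQ⟩ := S.cone u Q hu
  have hval : ∀ y, ⟪Q, y⟫ = r * ⟪N i, y⟫ + s * ⟪N j, y⟫ + t * ⟪N k, y⟫ := by
    intro y
    rw [hQ, inner_add_left, inner_add_left, real_inner_smul_left, real_inner_smul_left,
      real_inner_smul_left]
  have hpos : ∀ y ∈ F, r * (c i - ⟪N i, y⟫) = 0 ∧ s * (c j - ⟪N j, y⟫) = 0 ∧
      t * (c k - ⟪N k, y⟫) = 0 := by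
    intro y hy
    obtain ⟨hy, he⟩ := (hmem y).1 hy
    rw [hval, hval (x u), hi, hj, hk] at he
    have h1 := mul_nonneg hr (sub_nonneg.2 (S.le_hull i hy))
    have h2 := mul_nonneg hs (sub_nonneg.2 (S.le_hull j hy))
    have h3 := mul_nonneg ht (sub_nonneg.2 (S.le_hull k hy))
    refine ⟨?_, ?_, ?_⟩ <;> linarith
  have hz : ∀ {t : ℝ} {k : ι} {y : E}, t ≠ 0 → t * (c k - ⟪N k, y⟫) = 0 → ⟪N k, y⟫ = c k := by
    intro t k y h0 h
    have := (mul_eq_zero.1 h).resolve_left h0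
    linarith
  -- The number of nonzero coefficients decides: none gives the whole polytope, one a facet, two or
  -- more an intersection of facets.
  by_cases hr0 : r = 0 <;> by_cases hs0 : s = 0 <;> by_cases ht0 : t = 0
  · left
    ext y
    rw [hmem, hval, hval]
    simp [hr0, hs0, ht0]
  · right; left
    refine ⟨k, fun y hy he => (hmem y).2 ⟨hy, ?_⟩⟩
    rw [hval, hval, hr0, hs0, he, hk]
    ring
  · right; left
    refine ⟨j, fun y hy he => (hmem y).2 ⟨hy, ?_⟩⟩
    rw [hval, hval, hr0, ht0, he, hj]
    ring
  · right; right
    exact ⟨j, k, hjk, fun y hy => ⟨hz hs0 (hpos y hy).2.1, hz ht0 (hpos y hy).2.2⟩⟩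
  · right; left
    refine ⟨i, fun y hy he => (hmem y).2 ⟨hy, ?_⟩⟩
    rw [hval, hval, hs0, ht0, he, hi]
    ring
  · right; right
    exact ⟨i, k, hik, fun y hy => ⟨hz hr0 (hpos y hy).1, hz ht0 (hpos y hy).2.2⟩⟩
  · right; right
    exact ⟨i, j, hij, fun y hy => ⟨hz hr0 (hpos y hy).1, hz hs0 (hpos y hy).2.1⟩⟩
  · right; right
    exact ⟨i, j, hij, fun y hy => ⟨hz hr0 (hpos y hy).1, hz hs0 (hpos y hy).2.1⟩⟩

theorem three_le_dim_hull [FiniteDimensional ℝ E] : 3 ≤ dim (convexHull ℝ (Set.range x)) := by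
  obtain ⟨u, v, w, z, i, huv, hu, hv, hw, hz, hu', hv', hw'⟩ := S.base
  exact three_le_dim (N := N i) (M := N b) (mem_hull u) (mem_hull v) (mem_hull w) (mem_hull z)
    (fun h => huv (S.injective h)) (hu'.trans hv'.symm) (hv' ▸ hw') (hu.trans hv.symm)
    (hw.trans hv.symm) (hv ▸ hz)

theorem two_le_dim_facet [FiniteDimensional ℝ E] {F : Set E} (i : ι)
    (hF : ∀ y ∈ convexHull ℝ (Set.range x), ⟪N i, y⟫ = c i → y ∈ F) : 2 ≤ dim F := by
  by_cases hb : i = b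
  · subst hb
    obtain ⟨u, v, w, z, j, huv, hu, hv, hw, hz, hu', hv', hw'⟩ := S.base
    exact two_le_dim (N := N j) (hF _ (mem_hull u) hu) (hF _ (mem_hull v) hv)
      (hF _ (mem_hull w) hw) (fun h => huv (S.injective h)) (hu'.trans hv'.symm) (hv' ▸ hw')
  · obtain ⟨u, v, w, huv, hu, hv, hw, hu', hv', hw'⟩ := S.side i hb
    exact two_le_dim (N := N b) (hF _ (mem_hull u) hu) (hF _ (mem_hull v) hv)
      (hF _ (mem_hull w) hw) (fun h => huv (S.injective h)) (hu'.trans hv'.symm) (hv' ▸ hw')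

theorem dim_le_one [FiniteDimensional ℝ E] (hE : Module.finrank ℝ E = 3) {F : Set E} {i j : ι}
    (hij : i ≠ j) (h : ∀ y ∈ F, ⟪N i, y⟫ = c i ∧ ⟪N j, y⟫ = c j) : dim F ≤ 1 := by
  have := dim_add_le (F := F) _ (S.indep i j hij) (by omega) (by
    intro y hy z hz k
    fin_cases k
    · exact (h y hy).1.trans (h z hz).1.symm
    · exact (h y hy).2.trans (h z hz).2.symm)
  push_cast at this
  omega

theorem isTreetope [FiniteDimensional ℝ E] (hE : Module.finrank ℝ E = 3) [Finite V] :
    IsTreetope 3 (convexHull ℝ (Set.range x)) := by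
  have hdim : dim (convexHull ℝ (Set.range x)) = 3 := by
    refine le_antisymm ?_ S.three_le_dim_hull
    have := dim_add_le (F := convexHull ℝ (Set.range x)) (![] : Fin 0 → E)
      linearIndependent_empty_type (by omega) (fun y _ z _ i => i.elim0)
    push_cast at this
    omega
  obtain ⟨u, v, w, z, i, huv, hu, hv, hw, hz, hu', hv', hw'⟩ := S.base
  have hib : i ≠ b := by
    rintro rfl; exact hw' hw
  refine ⟨⟨_, Set.finite_range x, rfl⟩, by exact_mod_cast hdim,
    {y ∈ convexHull ℝ (Set.range x) | ⟪N b, y⟫ = c b}, ⟨S.isFace_single hu, ?_⟩, ?_⟩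
  · rw [hdim]
    have h2 := S.two_le_dim_facet (F := {y ∈ convexHull ℝ (Set.range x) | ⟪N b, y⟫ = c b}) b
      (fun y hy he => ⟨hy, he⟩)
    have hNb : LinearIndependent ℝ ![N b] := by
      have := (S.indep b i hib.symm).ne_zero 0
      simpa using this
    have := dim_add_le (F := {y ∈ convexHull ℝ (Set.range x) | ⟪N b, y⟫ = c b}) _ hNb (by omega)
      (by
        intro y hy z hz k
        fin_cases k
        exact hy.2.trans hz.2.symm)
    push_cast at this
    omega
  · intro F hF hsub
    by_cases hne : F.Nonempty
    -- A face containing two vertices of the base violates `hsub`. This excludes the polytope and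
    -- every face that contains a facet; the rest lie in two facets and have dimension at most one.
    · have key : ∀ u v, u ≠ v → x u ∈ F → x v ∈ F → ⟪N b, x u⟫ = c b → ⟪N b, x v⟫ = c b → False :=
        fun u v huv h1 h2 h3 h4 =>
          huv (S.injective (hsub ⟨h1, mem_hull u, h3⟩ ⟨h2, mem_hull v, h4⟩))
      rcases S.face_cases hF hne with h | ⟨j, h⟩ | ⟨j, k, hjk, h⟩
      · rw [h] at key
        exact (key u v huv (mem_hull u) (mem_hull v) hu hv).elim
      · by_cases hb : j = b
        · subst hb
          exact (key u v huv (h _ (mem_hull u) hu) (h _ (mem_hull v) hv) hu hv).elim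
        · obtain ⟨u, v, w, huv, hu, hv, hw, hu', hv', hw'⟩ := S.side j hb
          exact (key u v huv (h _ (mem_hull u) hu) (h _ (mem_hull v) hv) hu' hv').elim
      · exact S.dim_le_one hE hjk h
    · rw [dim, if_neg hne]
      omega

theorem nonempty_iso [FiniteDimensional ℝ E] (hE : Module.finrank ℝ E = 3) [Finite V] :
    Nonempty (G ≃g polytopeGraph (convexHull ℝ (Set.range x))) := by
  let φ : V → Vertex (convexHull ℝ (Set.range x)) := fun u => ⟨x u, S.isFace_vertex u⟩
  have hφ : Function.Bijective φ := by
    refine ⟨fun u v h => S.injective (congrArg Subtype.val h), ?_⟩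
    rintro ⟨y, hy⟩
    -- Exposed points are extreme, and extreme points of a hull are among the generating points.
    have h1 : y ∈ (convexHull ℝ (Set.range x)).extremePoints ℝ :=
      exposedPoints_subset_extremePoints (mem_exposedPoints_iff_exposed_singleton.2 hy)
    obtain ⟨u, hu⟩ := extremePoints_convexHull_subset h1
    exact ⟨u, Subtype.ext hu⟩
  refine ⟨⟨Equiv.ofBijective φ hφ, ?_⟩⟩
  intro u v
  change (φ u ≠ φ v ∧ ∃ F : Set E, IsFace _ F ∧ dim F = 1 ∧ x u ∈ F ∧ x v ∈ F) ↔ G.Adj u v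
  constructor
  · rintro ⟨hne, F, hF, hd, hu, hv⟩
    rw [S.adj u v (fun h => hne (congrArg φ h))]
    rcases S.face_cases hF ⟨_, hu⟩ with h | ⟨j, h⟩ | ⟨i, j, hij, h⟩
    · have := S.three_le_dim_hull
      rw [← h] at this
      omega
    · have := S.two_le_dim_facet j h
      omega
    · exact ⟨i, j, hij, (h _ hu).1, (h _ hv).1, (h _ hu).2, (h _ hv).2⟩
  · intro h
    have hne := h.ne
    obtain ⟨i, j, hij, h1, h2, h3, h4⟩ := (S.adj u v hne).1 h
    refine ⟨fun h => hne (hφ.1 h), _, S.isFace_pair h1 h3, le_antisymm ?_ ?_,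
      ⟨mem_hull u, h1, h3⟩, ⟨mem_hull v, h2, h4⟩⟩
    · exact S.dim_le_one hE hij (fun y hy => hy.2)
    · exact one_le_dim ⟨mem_hull u, h1, h3⟩ ⟨mem_hull v, h2, h4⟩ (fun h => hne (S.injective h))

end FacetSystem

end FacetSystem

/-! ### Combinatorics of gap labellings -/

section Gaps

variable {V : Type*} {T : SimpleGraph V} {n : ℕ} {g : T.Dart → ℕ}

/-- The gap `i` is incident to the vertex `v`. -/
def HasGap (g : T.Dart → ℕ) (v : V) (i : ℕ) : Prop :=
  ∃ d : T.Dart, d.fst = v ∧ (g d = i ∨ g d.symm = i)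

theorem hasGap_leaf {v : V} (hv : IsLeaf T v) {d : T.Dart} (hd : d.fst = v) {i : ℕ} :
    HasGap g v i ↔ g d = i ∨ g d.symm = i := by
  constructor
  · rintro ⟨e, he, h⟩
    rwa [hv.dart_eq hd he]
  · exact fun h => ⟨d, hd, h⟩

namespace GapLabelling

variable (hg : GapLabelling T n g)
include hg

theorem hasGap_interior {v : V} (hv : ¬ IsLeaf T v) {i : ℕ} :
    HasGap g v i ↔ ∃ d : T.Dart, d.fst = v ∧ g d = i := by
  constructor
  · rintro ⟨e, rfl, h | h⟩
    · exact ⟨e, rfl, h⟩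
    · obtain ⟨f, hf, hfe⟩ := hg.exists_next e hv
      exact ⟨f, hf, hfe.trans h⟩
  · rintro ⟨d, hd, h⟩
    exact ⟨d, hd, Or.inl h⟩

theorem lt_of_hasGap {v : V} {i : ℕ} (h : HasGap g v i) : i < n := by
  obtain ⟨d, _, h | h⟩ := h <;> rw [← h] <;> exact hg.lt _

/-- Gaps at the start of a dart are not strictly beyond it. -/
theorem not_cyc_of_hasGap {d : T.Dart} {i : ℕ} (h : HasGap g d.fst i) :
    ¬ Cyc (g d) i (g d.symm) := by
  by_cases hl : IsLeaf T d.fst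
  · rw [hasGap_leaf hl rfl] at h
    unfold Cyc
    omega
  · obtain ⟨e, he, rfl⟩ := (hg.hasGap_interior hl).1 h
    exact hg.not_cyc d e he.symm hl

/-- The labels at `v` cut the cycle of gaps into arcs, and a missing gap is interior to one of them.
This arc starts at the largest label below `i`, or at the largest label of all if none is below. -/
theorem exists_cyc [Finite V] {v : V} (hv : ∃ d : T.Dart, d.fst = v) {i : ℕ} (hi : i < n)
    (h : ¬ HasGap g v i) : ∃ d : T.Dart, d.fst = v ∧ Cyc (g d) i (g d.symm) := by
  by_cases hl : IsLeaf T v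
  · obtain ⟨d, hd⟩ := hv
    refine ⟨d, hd, ?_⟩
    rw [hasGap_leaf hl hd] at h
    have h1 := hg.leaf d (hd ▸ hl)
    have h2 := hg.lt d
    have h3 := hg.lt d.symm
    unfold Cyc
    omega
  · rw [hg.hasGap_interior hl] at h
    push Not at h
    obtain ⟨hi', hhi', hmax⟩ := Set.exists_max_image {d : T.Dart | d.fst = v} g (Set.toFinite _) hv
    change hi'.fst = v at hhi'
    by_cases hne : ∃ d : T.Dart, d.fst = v ∧ g d < i
    · obtain ⟨d, ⟨hd, hdi⟩, hdmax⟩ := Set.exists_max_image {d : T.Dart | d.fst = v ∧ g d < i} g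
        (Set.toFinite _) hne
      refine ⟨d, hd, ?_⟩
      obtain ⟨f, hf, hfe⟩ := hg.exists_next d (hd ▸ hl)
      have h1 := h f (hf.trans hd)
      have h2 : g f < i → g f ≤ g d := fun hlt => hdmax f ⟨hf.trans hd, hlt⟩
      have h3 := hg.symm_ne d
      have h4 := hmax d hd
      have h5 := hg.not_cyc d hi' (hd.trans hhi'.symm) (hd ▸ hl)
      have h6 := h hi' hhi'
      have h7 : g hi' < i → g hi' ≤ g d := fun hlt => hdmax hi' ⟨hhi', hlt⟩
      unfold Cyc at h5 ⊢
      omega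
    · push Not at hne
      refine ⟨hi', hhi', ?_⟩
      obtain ⟨f, hf, hfe⟩ := hg.exists_next hi' (hhi' ▸ hl)
      have h1 := hne f (hf.trans hhi')
      have h2 := hmax f (hf.trans hhi')
      have h3 := hg.symm_ne hi'
      obtain ⟨lo, hlo, hmin⟩ := Set.exists_min_image {d : T.Dart | d.fst = v} g (Set.toFinite _)
        ⟨hi', hhi'⟩
      have h4 := hmin hi' hhi'
      have h5 := hne lo hlo
      have h6 := h lo hlo
      have h7 := h f (hf.trans hhi')
      unfold Cyc
      omega

/-- Crossing a dart away from the gap `i`, every further dart leads away from it. -/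
theorem not_cyc_step {d d' : T.Dart} (h : d'.fst = d.snd) (hne : d' ≠ d.symm) {i : ℕ}
    (hi : ¬ Cyc (g d) i (g d.symm)) : ¬ Cyc (g d') i (g d'.symm) := by
  have hs : d.symm.fst = d'.fst := h.symm
  have hl : ¬ IsLeaf T d'.fst := fun hl => hne (hl.dart_eq rfl hs)
  have hl' : ¬ IsLeaf T d.symm.fst := hs ▸ hl
  have h0 : g d' ≠ g d.symm := fun hh => hne (hg.inj _ _ hs.symm hh)
  obtain ⟨f0, hf0, hf0'⟩ := hg.exists_next d.symm hl'
  obtain ⟨f1, hf1, hf1'⟩ := hg.exists_next d' hl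
  have h1 := hg.not_cyc d.symm d' hs hl'
  have h2 := hg.not_cyc d' f0 (hs.symm.trans hf0.symm) hl
  have h3 := hg.not_cyc d' d.symm hs.symm hl
  have h4 := hg.not_cyc d.symm f1 (hs.trans hf1.symm) hl'
  have h5 := hg.symm_ne d
  have h6 := hg.symm_ne d'
  rw [hf0'] at h2
  rw [hf1'] at h4
  rw [SimpleGraph.Dart.symm_symm] at h1 h2 h4
  unfold Cyc at *
  omega

/-- Two consecutive darts of a path do not have the same pair of gaps. -/
theorem pair_ne {d d' : T.Dart} (h : d'.fst = d.snd) (hne : d' ≠ d.symm) {i j : ℕ} (hij : i ≠ j)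
    (h1 : i = g d ∨ i = g d.symm) (h2 : j = g d ∨ j = g d.symm)
    (h3 : i = g d' ∨ i = g d'.symm) (h4 : j = g d' ∨ j = g d'.symm) : False := by
  have hs : d.symm.fst = d'.fst := h.symm
  have hl : ¬ IsLeaf T d'.fst := fun hl => hne (hl.dart_eq rfl hs)
  have hl' : ¬ IsLeaf T d.symm.fst := hs ▸ hl
  -- As the degree is at least three, a third label at the common vertex falls into one of the two
  -- arcs cut out by `i` and `j`, and both should be free of labels.
  obtain ⟨k, hk, hk1, hk2⟩ := hg.third d' d.symm hs.symm hl
  have h0 : g d' ≠ g d.symm := fun hh => hne (hg.inj _ _ hs.symm hh)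
  have e1 : g k ≠ g d' := fun hh => hk1 (hg.inj _ _ hk hh)
  have e2 : g k ≠ g d.symm := fun hh => hk2 (hg.inj _ _ (hk.trans hs.symm) hh)
  have e3 := hg.not_cyc d.symm k (hs.trans hk.symm) hl'
  have e4 := hg.not_cyc d' k hk.symm hl
  rw [SimpleGraph.Dart.symm_symm] at e3
  unfold Cyc at *
  omega

theorem exists_leaf_symm {i : ℕ} (hi : i < n) : ∃ d : T.Dart, IsLeaf T d.fst ∧ g d.symm = i := by
  have hn := hg.three_le
  by_cases h : i + 1 = n
  · obtain ⟨d, hd, h0⟩ := hg.exists_leaf 0 (by omega)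
    refine ⟨d, hd, ?_⟩
    have := hg.leaf d hd
    omega
  · obtain ⟨d, hd, h0⟩ := hg.exists_leaf (i + 1) (by omega)
    refine ⟨d, hd, ?_⟩
    have := hg.leaf d hd
    omega

theorem leaf_symm_inj {d e : T.Dart} (hd : IsLeaf T d.fst) (he : IsLeaf T e.fst)
    (h : g d.symm = g e.symm) : d = e := by
  refine hg.leaf_inj d e hd he ?_
  have h1 := hg.leaf d hd
  have h2 := hg.leaf e he
  have h3 := hg.lt d
  have h4 := hg.lt e
  omega

end GapLabelling

end Gaps

/-! ### Vectors on the moment curve -/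

section Moment

open scoped RealInnerProductSpace

/-- Euclidean three-space. -/
abbrev E3 : Type := EuclideanSpace ℝ (Fin 3)

/-- A point of the moment curve, at height one. -/
def mom (i : ℕ) : E3 := !₂[1, (i : ℝ), (i : ℝ) ^ 2]

/-- The cross product. -/
def cross (a b : E3) : E3 :=
  !₂[a 1 * b 2 - a 2 * b 1, a 2 * b 0 - a 0 * b 2, a 0 * b 1 - a 1 * b 0]

/-- The determinant of three vectors. -/
def tri (a b c : E3) : ℝ := ⟪cross a b, c⟫

theorem inner_eq (a b : E3) : ⟪a, b⟫ = a 0 * b 0 + a 1 * b 1 + a 2 * b 2 := by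
  simp [PiLp.inner_apply, Fin.sum_univ_three, mul_comm]

theorem tri_eq (a b c : E3) : tri a b c = (a 1 * b 2 - a 2 * b 1) * c 0 +
    (a 2 * b 0 - a 0 * b 2) * c 1 + (a 0 * b 1 - a 1 * b 0) * c 2 := by
  rw [tri, inner_eq]; rfl

theorem tri_rotate (a b c : E3) : tri a b c = tri b c a := by
  simp only [tri_eq]; ring

theorem tri_swap (a b c : E3) : tri a b c = -tri b a c := by
  simp only [tri_eq]; ring

theorem tri_self_left (a b : E3) : tri a b a = 0 := by
  simp only [tri_eq]; ring

theorem tri_self_right (a b : E3) : tri a b b = 0 := by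
  simp only [tri_eq]; ring

theorem cross_swap (a b : E3) : cross a b = -cross b a := by
  ext i
  fin_cases i <;> simp [cross] <;> ring

/-- Cramer's rule, used for the coordinates in a basis of normals. -/
theorem tri_smul (a b c q : E3) :
    tri a b c • q = tri b c q • a + tri c a q • b + tri a b q • c := by
  ext i
  simp only [tri_eq, PiLp.add_apply, PiLp.smul_apply, smul_eq_mul]
  fin_cases i <;> simp <;> ring

theorem eq_zero_of_inner {a b c y : E3} (h : tri a b c ≠ 0) (ha : ⟪a, y⟫ = 0) (hb : ⟪b, y⟫ = 0)
    (hc : ⟪c, y⟫ = 0) : y = 0 := by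
  have : tri a b c • y = ⟪a, y⟫ • cross b c + ⟪b, y⟫ • cross c a + ⟪c, y⟫ • cross a b := by
    ext i
    simp only [tri_eq, inner_eq, PiLp.add_apply, PiLp.smul_apply, smul_eq_mul]
    fin_cases i <;> simp [cross] <;> ring
  rw [ha, hb, hc, zero_smul, zero_smul, zero_smul, add_zero, add_zero, smul_eq_zero] at this
  exact this.resolve_left h

theorem linearIndependent_of_tri {a b c : E3} (h : tri a b c ≠ 0) :
    LinearIndependent ℝ ![a, b] := by
  rw [LinearIndependent.pair_iff]
  intro s t hst
  have h1 : tri (s • a + t • b) b c = s * tri a b c := by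
    simp only [tri_eq, PiLp.add_apply, PiLp.smul_apply, smul_eq_mul]; ring
  have h2 : tri a (s • a + t • b) c = t * tri a b c := by
    simp only [tri_eq, PiLp.add_apply, PiLp.smul_apply, smul_eq_mul]; ring
  have h3 : tri 0 b c = 0 := by simp [tri_eq]
  have h4 : tri a 0 c = 0 := by simp [tri_eq]
  rw [hst] at h1 h2
  exact ⟨(mul_eq_zero.1 (h1.symm.trans h3)).resolve_right h,
    (mul_eq_zero.1 (h2.symm.trans h4)).resolve_right h⟩

/-- A Vandermonde determinant; its sign records the cyclic order of the indices. -/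
theorem tri_mom (i j k : ℕ) :
    tri (mom i) (mom j) (mom k) = ((j : ℝ) - i) * ((k : ℝ) - i) * ((k : ℝ) - j) := by
  simp [tri_eq, mom]; ring

theorem tri_mom_pos {i j k : ℕ} (h : Cyc i j k) : 0 < tri (mom i) (mom j) (mom k) := by
  have key : ∀ {i j k : ℕ}, i < j → j < k → 0 < tri (mom i) (mom j) (mom k) := by
    intro i j k h1 h2
    rw [tri_mom]
    have h1' : (i : ℝ) < j := by exact_mod_cast h1
    have h2' : (j : ℝ) < k := by exact_mod_cast h2
    exact mul_pos (mul_pos (by linarith) (by linarith)) (by linarith)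
  rcases h with ⟨h1, h2⟩ | ⟨h1, h2⟩ | ⟨h1, h2⟩
  · exact key h1 h2
  · rw [tri_rotate]; exact key h1 h2
  · rw [tri_rotate, tri_rotate]; exact key h1 h2

theorem tri_mom_ne_zero {i j k : ℕ} (h1 : i ≠ j) (h2 : i ≠ k) (h3 : j ≠ k) :
    tri (mom i) (mom j) (mom k) ≠ 0 := by
  rw [tri_mom]
  have h1' : (i : ℝ) ≠ j := by exact_mod_cast h1
  have h2' : (i : ℝ) ≠ k := by exact_mod_cast h2
  have h3' : (j : ℝ) ≠ k := by exact_mod_cast h3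
  exact mul_ne_zero (mul_ne_zero (sub_ne_zero.2 h1'.symm) (sub_ne_zero.2 h2'.symm))
    (sub_ne_zero.2 h3'.symm)

variable {V : Type*} {T : SimpleGraph V}

/-- The direction of the edge of the polytope along a dart. -/
def edgeDir (g : T.Dart → ℕ) (d : T.Dart) : E3 := cross (mom (g d.symm)) (mom (g d))

theorem edgeDir_symm (g : T.Dart → ℕ) (d : T.Dart) : edgeDir g d.symm = -edgeDir g d := by
  rw [edgeDir, edgeDir, SimpleGraph.Dart.symm_symm, cross_swap]

theorem inner_edgeDir (g : T.Dart → ℕ) (d : T.Dart) (q : E3) :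
    ⟪edgeDir g d, q⟫ = tri (mom (g d.symm)) (mom (g d)) q := rfl

/-- With the next two lemmas: along `d`, the functional of a gap increases strictly beyond the dart,
is constant for its two own gaps, and decreases otherwise. -/
theorem inner_edgeDir_pos {g : T.Dart → ℕ} {d : T.Dart} {i : ℕ} (h : Cyc (g d) i (g d.symm)) :
    0 < ⟪edgeDir g d, mom i⟫ := by
  rw [inner_edgeDir]
  refine tri_mom_pos ?_
  unfold Cyc at *
  omega

theorem inner_edgeDir_nonpos {g : T.Dart → ℕ} {d : T.Dart} {i : ℕ}
    (h : ¬ Cyc (g d) i (g d.symm)) : ⟪edgeDir g d, mom i⟫ ≤ 0 := by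
  rw [inner_edgeDir]
  by_cases h1 : i = g d
  · rw [h1, tri_self_right]
  by_cases h2 : i = g d.symm
  · rw [h2, tri_self_left]
  by_cases h3 : g d = g d.symm
  · rw [h3, tri_rotate, tri_rotate, tri_self_right]
  rw [tri_swap, neg_nonpos]
  refine (tri_mom_pos ?_).le
  unfold Cyc at *
  omega

theorem eq_of_inner_edgeDir_eq_zero {g : T.Dart → ℕ} {d : T.Dart} {i : ℕ} (hd : g d ≠ g d.symm)
    (h : ⟪edgeDir g d, mom i⟫ = 0) : i = g d ∨ i = g d.symm := by
  by_contra! hcon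
  exact tri_mom_ne_zero hd.symm hcon.2.symm hcon.1.symm h

/-- The outer normal of the base. -/
def baseNormal (n : ℕ) : E3 := -∑ i ∈ Finset.range n, mom i

/-- Seen from a leaf, all gaps but its own two lie beyond its edge, and `3 ≤ n` provides one. So the
base functional drops strictly from the leaf inward. -/
theorem GapLabelling.inner_edgeDir_base {n : ℕ} {g : T.Dart → ℕ} (hg : GapLabelling T n g)
    {d : T.Dart} (hd : IsLeaf T d.fst) : ⟪edgeDir g d, baseNormal n⟫ < 0 := by
  have h1 := hg.leaf d hd
  have h2 := hg.lt d
  have h3 := hg.lt d.symm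
  have h4 := hg.three_le
  have hc : ∀ i < n, i ≠ g d → i ≠ g d.symm → Cyc (g d) i (g d.symm) := by
    intro i hi _ _
    unfold Cyc
    omega
  rw [baseNormal, inner_neg_right, neg_lt_zero, inner_sum]
  refine Finset.sum_pos' ?_ ?_
  · intro i hi
    rw [Finset.mem_range] at hi
    by_cases e1 : i = g d
    · rw [e1, inner_edgeDir, tri_self_right]
    by_cases e2 : i = g d.symm
    · rw [e2, inner_edgeDir, tri_self_left]
    exact (inner_edgeDir_pos (hc i hi e1 e2)).le
  · obtain ⟨i, hi, e1, e2⟩ : ∃ i < n, i ≠ g d ∧ i ≠ g d.symm := by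
      by_contra! hcon
      have c0 := hcon 0 (by omega)
      have c1 := hcon 1 (by omega)
      have c2 := hcon 2 (by omega)
      omega
    exact ⟨i, Finset.mem_range.2 hi, inner_edgeDir_pos (hc i hi e1 e2)⟩

end Moment

/-! ### Realization of the tree -/

section Realization

open scoped RealInnerProductSpace

variable {V : Type*} {T : SimpleGraph V}

/-- An antisymmetric function on the darts of a tree is a difference. -/
theorem exists_potential {A : Type*} [AddCommGroup A] (hT : T.IsTree) (w : T.Dart → A)
    (hw : ∀ d, w d.symm = -w d) : ∃ y : V → A, ∀ d : T.Dart, y d.snd - y d.fst = w d := by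
  classical
  obtain ⟨r⟩ := hT.1.nonempty
  choose p hp using fun v => (hT.existsUnique_path r v).exists
  have key : ∀ (u v : V) (h : T.Adj u v), p v = (p u).concat h →
      ((p v).darts.map w).sum - ((p u).darts.map w).sum = w ⟨(u, v), h⟩ := by
    intro u v h he
    rw [he]
    simp [SimpleGraph.Walk.darts_concat]
  refine ⟨fun v => ((p v).darts.map w).sum, fun d => ?_⟩
  by_cases hd : d.fst ∈ (p d.snd).support
  · exact key _ _ d.adj (hT.2.path_concat (hp _) (hp _) d.adj hd)
  · have hm := hT.2.mem_support_of_ne_mem_support_of_adj_of_isPath (hp _) (hp _) d.adj hd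
    have := key _ _ d.adj.symm (hT.2.path_concat (hp _) (hp _) d.adj.symm hm)
    rw [← neg_inj, neg_sub, ← hw]
    exact this

theorem exists_realization [Finite V] (hT : T.IsTree) {n : ℕ} {g : T.Dart → ℕ}
    (hg : GapLabelling T n g) : ∃ (x : V → E3) (K : ℝ),
      (∀ d : T.Dart, ∃ c : ℝ, 0 < c ∧ x d.snd - x d.fst = c • edgeDir g d) ∧
      (∀ v, IsLeaf T v → ⟪baseNormal n, x v⟫ = K) ∧
      (∀ v, ¬ IsLeaf T v → ⟪baseNormal n, x v⟫ < K) := by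
  classical
  obtain ⟨y, hy⟩ := exists_potential hT (edgeDir g) (edgeDir_symm g)
  obtain ⟨d0, _, _⟩ := hg.exists_leaf 0 (by have := hg.three_le; omega)
  have : Nonempty V := ⟨d0.fst⟩
  have : Nontrivial V := ⟨d0.fst, d0.snd, d0.fst_ne_snd⟩
  have hδ : ∀ v, ∃ d : T.Dart, d.fst = v := fun v => by
    obtain ⟨w, hw⟩ := hT.1.preconnected.exists_adj_of_nontrivial v
    exact ⟨⟨(v, w), hw⟩, rfl⟩
  choose δ hδ using hδ
  obtain ⟨m, hm⟩ := Finite.exists_max (fun v => ⟪baseNormal n, y v⟫)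
  set K := ⟪baseNormal n, y m⟫ + 1 with hK
  have hlt : ∀ v, ⟪baseNormal n, y v⟫ < K := fun v => by have := hm v; linarith
  -- The parameter at which the line of the leaf's edge meets the base plane. It is negative at a
  -- leaf, where `edgeDir` points inward, so the edge only gets longer.
  let s : V → ℝ := fun v => (K - ⟪baseNormal n, y v⟫) / ⟪baseNormal n, edgeDir g (δ v)⟫
  have hB : ∀ v, IsLeaf T v → ⟪baseNormal n, edgeDir g (δ v)⟫ < 0 := fun v hv => by
    rw [real_inner_comm]
    exact hg.inner_edgeDir_base (by rwa [hδ])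
  have hs : ∀ v, IsLeaf T v → s v < 0 := fun v hv =>
    div_neg_of_pos_of_neg (sub_pos.2 (hlt v)) (hB v hv)
  let x : V → E3 := fun v => if IsLeaf T v then y v + s v • edgeDir g (δ v) else y v
  have hx1 : ∀ v, IsLeaf T v → x v = y v + s v • edgeDir g (δ v) := fun v hv => if_pos hv
  have hx2 : ∀ v, ¬ IsLeaf T v → x v = y v := fun v hv => if_neg hv
  have hleaf : ∀ d : T.Dart, IsLeaf T d.fst →
      ∃ c : ℝ, 0 < c ∧ x d.snd - x d.fst = c • edgeDir g d := by
    intro d hd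
    refine ⟨1 - s d.fst, by have := hs _ hd; linarith, ?_⟩
    rw [hx1 _ hd, hx2 _ (hg.leaf_snd d hd), hd.dart_eq (hδ d.fst) rfl, sub_smul, one_smul, ← hy d]
    abel
  refine ⟨x, K, ?_, ?_, ?_⟩
  · intro d
    by_cases h1 : IsLeaf T d.fst
    · exact hleaf d h1
    by_cases h2 : IsLeaf T d.snd
    · obtain ⟨c, hc, h⟩ := hleaf d.symm h2
      refine ⟨c, hc, ?_⟩
      rw [edgeDir_symm, smul_neg] at h
      rw [← neg_inj, ← h, neg_sub]
      rfl
    · exact ⟨1, one_pos, by rw [hx2 _ h1, hx2 _ h2, hy, one_smul]⟩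
  · intro v hv
    rw [hx1 v hv, inner_add_right, real_inner_smul_right, div_mul_cancel₀ _ (hB v hv).ne]
    ring
  · intro v hv
    rw [hx2 v hv]
    exact hlt v

end Realization

/-! ### Facets and normal cones of the realization -/

section Facets

open scoped RealInnerProductSpace

theorem exists_coords {a b c : E3} (h : tri a b c ≠ 0) (q : E3) :
    q = (tri b c q / tri a b c) • a + (tri c a q / tri a b c) • b +
      (tri a b q / tri a b c) • c := by
  have h1 := congrArg (fun y => (tri a b c)⁻¹ • y) (tri_smul a b c q)
  simp only [smul_add, smul_smul, inv_mul_cancel₀ h, one_smul] at h1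
  simpa only [div_eq_inv_mul] using h1

variable {V : Type*} {T : SimpleGraph V} {n : ℕ} {g : T.Dart → ℕ} {x : V → E3}

theorem exists_dart (hT : T.IsTree) (hg : GapLabelling T n g) (v : V) :
    ∃ d : T.Dart, d.fst = v := by
  obtain ⟨d0, _, _⟩ := hg.exists_leaf 0 (by have := hg.three_le; omega)
  have : Nontrivial V := ⟨d0.fst, d0.snd, d0.fst_ne_snd⟩
  obtain ⟨w, hw⟩ := hT.1.preconnected.exists_adj_of_nontrivial v
  exact ⟨⟨(v, w), hw⟩, rfl⟩

/-- At an interior vertex, the cone cut out by the incident edges is spanned by the incident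
normals. -/
theorem GapLabelling.cone_interior [Finite V] (hg : GapLabelling T n g) {v : V} (hl : ¬ IsLeaf T v)
    (hv : ∃ d : T.Dart, d.fst = v) {q : E3}
    (hq : ∀ d : T.Dart, d.fst = v → ⟪edgeDir g d, q⟫ ≤ 0) :
    ∃ a b c : T.Dart, a.fst = v ∧ b.fst = v ∧ c.fst = v ∧ g a < g b ∧ g b < g c ∧
      ∃ r s t : ℝ, 0 ≤ r ∧ 0 ≤ s ∧ 0 ≤ t ∧
        q = r • mom (g a) + s • mom (g b) + t • mom (g c) := by
  have hq' : ∀ d e : T.Dart, d.fst = v → g e = g d.symm → 0 ≤ tri (mom (g d)) (mom (g e)) q := by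
    intro d e hd he
    have := hq d hd
    rw [inner_edgeDir, tri_swap, ← he] at this
    linarith
  obtain ⟨lo, hlo, hmin⟩ := Set.exists_min_image {d : T.Dart | d.fst = v} g (Set.toFinite _) hv
  obtain ⟨hi, hhi, hmax⟩ := Set.exists_max_image {d : T.Dart | d.fst = v} g (Set.toFinite _) hv
  change lo.fst = v at hlo
  change hi.fst = v at hhi
  obtain ⟨m, hm, hmlo, hmhi⟩ := hg.third lo hi (hlo.trans hhi.symm) (hlo ▸ hl)
  have hml : g m ≠ g lo := fun h => hmlo (hg.inj _ _ hm h)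
  have hmh : g m ≠ g hi := fun h => hmhi (hg.inj _ _ (hm.trans (hlo.trans hhi.symm)) h)
  have hml' := hmin m (hm.trans hlo)
  have hmh' := hmax m (hm.trans hlo)
  obtain ⟨r, hr, hrg⟩ := hg.exists_next lo (hlo ▸ hl)
  have hrv : r.fst = v := hr.trans hlo
  have hr1 := hg.not_cyc lo m hm.symm (hlo ▸ hl)
  have hr2 := hg.symm_ne lo
  have hr3 := hmin r hrv
  have hrhi : g r < g hi := by
    have := hmax r hrv
    unfold Cyc at hr1
    omega
  -- The normals at `v` span the cone over a convex polygon, and `hq'` puts `q` on the inner side of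
  -- each of its sides. In the fan triangulation from `lo`, the triangle containing `q` follows the
  -- last diagonal with `q` on its nonnegative side.
  obtain ⟨f, ⟨hf, hflo, hfhi, hfq⟩, hfmax⟩ := Set.exists_max_image
    {d : T.Dart | d.fst = v ∧ g lo < g d ∧ g d < g hi ∧ 0 ≤ tri (mom (g lo)) (mom (g d)) q} g
    (Set.toFinite _) ⟨r, hrv, by omega, hrhi, hq' lo r hlo hrg⟩
  obtain ⟨c, hc, hcg⟩ := hg.exists_next f (hf ▸ hl)
  have hcv : c.fst = v := hc.trans hf
  have hfc : g f < g c := by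
    have h1 := hg.not_cyc f hi (hf.trans hhi.symm) (hf ▸ hl)
    have h2 := hg.symm_ne f
    unfold Cyc at h1
    omega
  have hs : tri (mom (g lo)) (mom (g c)) q ≤ 0 := by
    by_cases hchi : g c < g hi
    · by_contra! hcon
      have := hfmax c ⟨hcv, by omega, hchi, hcon.le⟩
      omega
    -- Here the triangle is the last of the fan, and its bound is the closing side from `hi` to
    -- `lo`.
    · have hc1 : g c = g hi := le_antisymm (hmax c hcv) (by omega)
      have h1 := hg.not_cyc hi lo (hhi.trans hlo.symm) (hhi ▸ hl)
      have h2 := hg.symm_ne hi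
      obtain ⟨e, he, heg⟩ := hg.exists_next hi (hhi ▸ hl)
      have h3 := hmin e (he.trans hhi)
      have h4 := hmax e (he.trans hhi)
      have h5 := hq' hi lo hhi (by unfold Cyc at h1; omega)
      rw [hc1, tri_swap]
      linarith
  have hD : 0 < tri (mom (g lo)) (mom (g f)) (mom (g c)) := tri_mom_pos (Or.inl ⟨hflo, hfc⟩)
  refine ⟨lo, f, c, hlo, hf, hcv, hflo, hfc, _, _, _, ?_, ?_, ?_, exists_coords hD.ne' q⟩
  · exact div_nonneg (hq' f c hf hcg) hD.le
  · refine div_nonneg ?_ hD.le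
    rw [tri_swap]
    linarith
  · exact div_nonneg hfq hD.le

variable (hg : GapLabelling T n g)
  (hx : ∀ d : T.Dart, ∃ c : ℝ, 0 < c ∧ x d.snd - x d.fst = c • edgeDir g d)

include hg in
theorem tri_base_pos {d : T.Dart} (hd : IsLeaf T d.fst) :
    0 < tri (mom (g d)) (mom (g d.symm)) (baseNormal n) := by
  have := hg.inner_edgeDir_base hd
  rw [inner_edgeDir, tri_swap] at this
  linarith

include hg in
theorem exists_leaf_hasGap {d : T.Dart} (hd : IsLeaf T d.fst) :
    (∃ v, IsLeaf T v ∧ HasGap g v (g d) ∧ ¬ HasGap g v (g d.symm)) ∧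
    (∃ v, IsLeaf T v ∧ HasGap g v (g d.symm) ∧ ¬ HasGap g v (g d)) := by
  have h0 := hg.three_le
  have h1 := hg.leaf d hd
  constructor
  · obtain ⟨e, he, heg⟩ := hg.exists_leaf_symm (hg.lt d)
    refine ⟨e.fst, he, ⟨e, rfl, Or.inr heg⟩, ?_⟩
    rw [hasGap_leaf he rfl]
    have := hg.leaf e he
    omega
  · obtain ⟨e, he, heg⟩ := hg.exists_leaf _ (hg.lt d.symm)
    refine ⟨e.fst, he, ⟨e, rfl, Or.inl heg⟩, ?_⟩
    rw [hasGap_leaf he rfl]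
    have := hg.leaf e he
    omega

include hx in
theorem exists_inner_sub (d : T.Dart) (q : E3) :
    ∃ c : ℝ, 0 < c ∧ ⟪q, x d.snd⟫ - ⟪q, x d.fst⟫ = c * ⟪edgeDir g d, q⟫ := by
  obtain ⟨c, hc, h⟩ := hx d
  exact ⟨c, hc, by rw [← inner_sub_right, h, real_inner_smul_right, real_inner_comm]⟩

include hx in
theorem inner_le_of_not_cyc {d : T.Dart} {i : ℕ} (h : ¬ Cyc (g d) i (g d.symm)) :
    ⟪mom i, x d.snd⟫ ≤ ⟪mom i, x d.fst⟫ := by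
  obtain ⟨c, hc, he⟩ := exists_inner_sub hx d (mom i)
  have := mul_nonpos_of_nonneg_of_nonpos hc.le (inner_edgeDir_nonpos h)
  linarith

include hg hx in
-- Once the path moves away from gap `i`, `not_cyc_step` keeps it doing so, and no step increases
-- the functional.
theorem inner_le_of_path {i : ℕ} {w v : V} (p : T.Walk w v) (hp : p.IsPath) {d : T.Dart}
    (hd : d.snd = w) (hnot : d.fst ∉ p.support) (hi : ¬ Cyc (g d) i (g d.symm)) :
    ⟪mom i, x v⟫ ≤ ⟪mom i, x w⟫ := by
  induction p generalizing d with
  | nil => exact le_rfl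
  | @cons a b c h p ih =>
    rw [SimpleGraph.Walk.cons_isPath_iff] at hp
    rw [SimpleGraph.Walk.support_cons, List.mem_cons, not_or] at hnot
    have hne : (⟨(a, b), h⟩ : T.Dart) ≠ d.symm := by
      intro he
      have : b = d.fst := congrArg (fun e : T.Dart => e.snd) he
      exact hnot.2 (this ▸ p.start_mem_support)
    have hstep := hg.not_cyc_step (d := d) (d' := ⟨(a, b), h⟩) hd.symm hne hi
    exact (ih hp.1 (d := ⟨(a, b), h⟩) rfl hp.2 hstep).trans
      (inner_le_of_not_cyc hx (d := ⟨(a, b), h⟩) hstep)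

include hg hx in
theorem inner_le_of_hasGap (hT : T.IsTree) {u : V} {i : ℕ} (hu : HasGap g u i) (v : V) :
    ⟪mom i, x v⟫ ≤ ⟪mom i, x u⟫ := by
  obtain ⟨p, hp, _⟩ := hT.existsUnique_path u v
  cases p with
  | nil => exact le_rfl
  | @cons _ w _ h p =>
    rw [SimpleGraph.Walk.cons_isPath_iff] at hp
    have hc := hg.not_cyc_of_hasGap (d := ⟨(u, w), h⟩) hu
    exact (inner_le_of_path hg hx p hp.1 (d := ⟨(u, w), h⟩) rfl hp.2 hc).trans
      (inner_le_of_not_cyc hx (d := ⟨(u, w), h⟩) hc)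

variable [Finite V]

include hg hx in
-- A vertex without the gap has a neighbour towards it with a strictly larger value.
theorem inner_lt_of_not_hasGap (hT : T.IsTree) {u v : V} {i : ℕ} (hu : HasGap g u i)
    (hv : ¬ HasGap g v i) : ⟪mom i, x v⟫ < ⟪mom i, x u⟫ := by
  obtain ⟨d, rfl, hd⟩ := hg.exists_cyc (exists_dart hT hg v) (hg.lt_of_hasGap hu) hv
  obtain ⟨c, hc, he⟩ := exists_inner_sub hx d (mom i)
  have h1 := mul_pos hc (inner_edgeDir_pos hd)
  have h2 := inner_le_of_hasGap hg hx hT hu d.snd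
  linarith

include hg hx in
theorem inner_eq_iff_hasGap (hT : T.IsTree) {u v : V} {i : ℕ} (hu : HasGap g u i) :
    ⟪mom i, x v⟫ = ⟪mom i, x u⟫ ↔ HasGap g v i := by
  constructor
  · intro h
    by_contra hv
    exact (inner_lt_of_not_hasGap hg hx hT hu hv).ne h
  · intro hv
    exact le_antisymm (inner_le_of_hasGap hg hx hT hu v) (inner_le_of_hasGap hg hx hT hv u)

include hg hx in
/-- Two vertices with a common gap have it in common with the first dart of the path between
them. -/
theorem hasGap_of_path (hT : T.IsTree) {u w v : V} {i : ℕ} (h : T.Adj u w) (p : T.Walk w v)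
    (hp : (SimpleGraph.Walk.cons h p).IsPath) (hu : HasGap g u i) (hv : HasGap g v i) :
    HasGap g w i ∧ (i = g ⟨(u, w), h⟩ ∨ i = g (⟨(u, w), h⟩ : T.Dart).symm) := by
  rw [SimpleGraph.Walk.cons_isPath_iff] at hp
  have hc := hg.not_cyc_of_hasGap (d := ⟨(u, w), h⟩) hu
  have h1 := inner_le_of_path hg hx p hp.1 (d := ⟨(u, w), h⟩) rfl hp.2 hc
  have h2 := inner_le_of_hasGap hg hx hT hu w
  have h3 := (inner_eq_iff_hasGap hg hx hT hu).2 hv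
  have h4 : ⟪mom i, x w⟫ = ⟪mom i, x u⟫ := by linarith
  refine ⟨(inner_eq_iff_hasGap hg hx hT hu).1 h4, ?_⟩
  obtain ⟨c, hc0, he⟩ := exists_inner_sub hx ⟨(u, w), h⟩ (mom i)
  refine eq_of_inner_edgeDir_eq_zero (hg.symm_ne _) ?_
  change ⟪mom i, x w⟫ - ⟪mom i, x u⟫ = _ at he
  rw [h4, sub_self] at he
  exact (mul_eq_zero.1 he.symm).resolve_left hc0.ne'

include hg hx in
-- Both common gaps would border the first two edges of a longer path, which `pair_ne` excludes.
theorem adj_of_hasGap (hT : T.IsTree) {u v : V} {i j : ℕ} (huv : u ≠ v) (hij : i ≠ j)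
    (hui : HasGap g u i) (hvi : HasGap g v i) (huj : HasGap g u j) (hvj : HasGap g v j) :
    T.Adj u v := by
  obtain ⟨p, hp, _⟩ := hT.existsUnique_path u v
  cases p with
  | nil => exact absurd rfl huv
  | @cons _ w _ h p =>
    obtain ⟨hwi, hi⟩ := hasGap_of_path hg hx hT h p hp hui hvi
    obtain ⟨hwj, hj⟩ := hasGap_of_path hg hx hT h p hp huj hvj
    cases p with
    | nil => exact h
    | @cons _ z _ h' p =>
      rw [SimpleGraph.Walk.cons_isPath_iff] at hp
      obtain ⟨_, hi'⟩ := hasGap_of_path hg hx hT h' p hp.1 hwi hvi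
      obtain ⟨_, hj'⟩ := hasGap_of_path hg hx hT h' p hp.1 hwj hvj
      refine (hg.pair_ne (d := ⟨(u, w), h⟩) (d' := ⟨(w, z), h'⟩) rfl ?_ hij hi hj hi' hj').elim
      intro he
      have : z = u := congrArg (fun e : T.Dart => e.snd) he
      refine hp.2 ?_
      rw [SimpleGraph.Walk.support_cons, ← this]
      exact List.mem_cons_of_mem _ p.start_mem_support

include hg hx in
theorem injective_realization (hT : T.IsTree) : Function.Injective x := by
  intro u v h
  by_contra huv
  obtain ⟨d, rfl⟩ := exists_dart hT hg u
  have key : ∀ i, HasGap g d.fst i → HasGap g v i := fun i hi =>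
    (inner_eq_iff_hasGap hg hx hT hi).1 (by rw [h])
  have h1 : HasGap g d.fst (g d) := ⟨d, rfl, Or.inl rfl⟩
  have h2 : HasGap g d.fst (g d.symm) := ⟨d, rfl, Or.inr rfl⟩
  have hadj := adj_of_hasGap hg hx hT huv (hg.symm_ne d) h1 (key _ h1) h2 (key _ h2)
  let e : T.Dart := ⟨(d.fst, v), hadj⟩
  -- This index differs from both gaps of `e`, so the functional is not constant along the edge.
  obtain ⟨c, hc, he⟩ := exists_inner_sub hx e (mom (g e + g e.symm + 1))
  change ⟪_, x v⟫ - ⟪_, x d.fst⟫ = _ at he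
  rw [h, sub_self] at he
  have := eq_of_inner_edgeDir_eq_zero (hg.symm_ne e) ((mul_eq_zero.1 he.symm).resolve_left hc.ne')
  omega

include hg hx in
theorem cone_leaf (hT : T.IsTree) {K : ℝ} (hK : ∀ v, IsLeaf T v → ⟪baseNormal n, x v⟫ = K)
    {d : T.Dart} (hd : IsLeaf T d.fst) {q : E3} (hq : ∀ v, ⟪q, x v⟫ ≤ ⟪q, x d.fst⟫) :
    ∃ r s t : ℝ, 0 ≤ r ∧ 0 ≤ s ∧ 0 ≤ t ∧
      q = r • mom (g d) + s • mom (g d.symm) + t • baseNormal n := by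
  have hD := tri_base_pos hg hd
  have hcoord := exists_coords hD.ne' q
  set r := tri (mom (g d.symm)) (baseNormal n) q / tri (mom (g d)) (mom (g d.symm)) (baseNormal n)
  set s := tri (baseNormal n) (mom (g d)) q / tri (mom (g d)) (mom (g d.symm)) (baseNormal n)
  set t := tri (mom (g d)) (mom (g d.symm)) q / tri (mom (g d)) (mom (g d.symm)) (baseNormal n)
    with ht
  have hval : ∀ v, r * ⟪mom (g d), x v⟫ + s * ⟪mom (g d.symm), x v⟫ + t * ⟪baseNormal n, x v⟫ ≤
      r * ⟪mom (g d), x d.fst⟫ + s * ⟪mom (g d.symm), x d.fst⟫ + t * ⟪baseNormal n, x d.fst⟫ := by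
    intro v
    have := hq v
    rw [hcoord] at this
    simpa only [inner_add_left, real_inner_smul_left] using this
  have h1 : HasGap g d.fst (g d) := ⟨d, rfl, Or.inl rfl⟩
  have h2 : HasGap g d.fst (g d.symm) := ⟨d, rfl, Or.inr rfl⟩
  obtain ⟨⟨v, hv, hv1, hv2⟩, ⟨w, hw, hw1, hw2⟩⟩ := exists_leaf_hasGap hg hd
  refine ⟨r, s, t, ?_, ?_, ?_, hcoord⟩
  -- The leaf `w` lies on the base and on the facet of `g d.symm`, so only the term of `r` changes
  -- from `d.fst` to `w`; the leaf `v` does the same for `s`.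
  · have e1 := inner_lt_of_not_hasGap hg hx hT h1 hw2
    have e2 := (inner_eq_iff_hasGap hg hx hT h2).2 hw1
    have e3 := hval w
    rw [e2, hK w hw, hK _ hd] at e3
    have e4 : r * (⟪mom (g d), x w⟫ - ⟪mom (g d), x d.fst⟫) ≤ 0 := by linarith
    exact nonneg_of_mul_nonpos_left e4 (sub_neg.2 e1)
  · have e1 := inner_lt_of_not_hasGap hg hx hT h2 hv2
    have e2 := (inner_eq_iff_hasGap hg hx hT h1).2 hv1
    have e3 := hval v
    rw [e2, hK v hv, hK _ hd] at e3
    have e4 : s * (⟪mom (g d.symm), x v⟫ - ⟪mom (g d.symm), x d.fst⟫) ≤ 0 := by linarith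
    exact nonneg_of_mul_nonpos_left e4 (sub_neg.2 e1)
  -- The tree edge at the leaf is orthogonal to both gap normals and isolates `t`.
  · obtain ⟨c, hc, he⟩ := exists_inner_sub hx d q
    have h3 : ⟪edgeDir g d, q⟫ ≤ 0 := by
      by_contra! hcon
      have := mul_pos hc hcon
      have := hq d.snd
      linarith
    rw [inner_edgeDir, tri_swap] at h3
    exact div_nonneg (by linarith) hD.le

end Facets

/-! ### The facet system of a Halin graph -/

section Main

open scoped RealInnerProductSpace

variable {V : Type*} [Finite V] {T : SimpleGraph V} {n : ℕ} {g : T.Dart → ℕ} {x : V → E3}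

/-- The outer normals of the facets: the base and one facet for each gap. -/
def facetNormal (n : ℕ) : Option (Fin n) → E3
  | none => baseNormal n
  | some i => mom i

theorem exists_facetSystem (hT : T.IsTree) (hg : GapLabelling T n g) {G : SimpleGraph V}
    (hG : ∀ u v, G.Adj u v ↔ T.Adj u v ∨ u ≠ v ∧ ∃ d e : T.Dart, IsLeaf T d.fst ∧
      IsLeaf T e.fst ∧ (d.fst = u ∧ e.fst = v ∨ d.fst = v ∧ e.fst = u) ∧ g d = g e.symm) :
    ∃ (x : V → E3) (c : Option (Fin n) → ℝ), FacetSystem G x (facetNormal n) c none := by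
  obtain ⟨x, K, hx, hK, hK'⟩ := exists_realization hT hg
  have hM : ∀ i : Fin n, ∃ m : ℝ, ∀ v, ⟪mom i, x v⟫ ≤ m ∧ (⟪mom i, x v⟫ = m ↔ HasGap g v i) := by
    intro i
    obtain ⟨d, _, hd⟩ := hg.exists_leaf i i.2
    have h : HasGap g d.fst i := ⟨d, rfl, Or.inl hd⟩
    exact ⟨_, fun v => ⟨inner_le_of_hasGap hg hx hT h v, inner_eq_iff_hasGap hg hx hT h⟩⟩
  choose M hM using hM
  have hMle : ∀ (i : Fin n) v, ⟪mom i, x v⟫ ≤ M i := fun i v => (hM i v).1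
  have hMeq : ∀ (i : Fin n) v, ⟪mom i, x v⟫ = M i ↔ HasGap g v i := fun i v => (hM i v).2
  have hKeq : ∀ v, ⟪baseNormal n, x v⟫ = K ↔ IsLeaf T v := fun v =>
    ⟨fun h => by_contra fun hv => (hK' v hv).ne h, hK v⟩
  have h3 := hg.three_le
  have hself : ∀ d : T.Dart, HasGap g d.fst (g d) := fun d => ⟨d, rfl, Or.inl rfl⟩
  have hself' : ∀ d : T.Dart, HasGap g d.fst (g d.symm) := fun d => ⟨d, rfl, Or.inr rfl⟩
  have hsnd : ∀ d : T.Dart, HasGap g d.snd (g d) := fun d => ⟨d.symm, rfl, Or.inr rfl⟩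
  have hinner : ∀ {u : V} {q : E3}, (∀ v, ⟪q, x v⟫ ≤ ⟪q, x u⟫) → ∀ d : T.Dart, d.fst = u →
      ⟪edgeDir g d, q⟫ ≤ 0 := by
    rintro u q hq d rfl
    obtain ⟨c, hc, he⟩ := exists_inner_sub hx d q
    by_contra! hcon
    have := mul_pos hc hcon
    have := hq d.snd
    linarith
  have hends : ∀ i < n, ∃ d e : T.Dart, IsLeaf T d.fst ∧ IsLeaf T e.fst ∧ g d = i ∧
      g e.symm = i ∧ d.fst ≠ e.fst := by
    intro i hi
    obtain ⟨d, hd, hdi⟩ := hg.exists_leaf i hi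
    obtain ⟨e, he, hei⟩ := hg.exists_leaf_symm hi
    refine ⟨d, e, hd, he, hdi, hei, fun h => ?_⟩
    rw [← hd.dart_eq rfl h.symm] at hei
    exact hg.symm_ne d (hdi.trans hei.symm)
  have hbase : ∀ i : Fin n, ∃ c : E3, tri (mom i) (baseNormal n) c ≠ 0 := by
    intro i
    obtain ⟨d, hd, hdi⟩ := hg.exists_leaf i i.2
    refine ⟨mom (g d.symm), ?_⟩
    rw [← hdi, tri_swap, neg_ne_zero, tri_rotate]
    exact (tri_base_pos hg hd).ne'
  -- A gap lies between just two leaves, one on each side, so distinct leaves sharing it are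
  -- consecutive.
  have hshare : ∀ {u v : V} {i : ℕ}, u ≠ v → IsLeaf T u → IsLeaf T v → HasGap g u i →
      HasGap g v i → G.Adj u v := by
    intro u v i huv hu hv hui hvi
    obtain ⟨d, rfl⟩ := exists_dart hT hg u
    obtain ⟨e, rfl⟩ := exists_dart hT hg v
    rw [hasGap_leaf hu rfl] at hui
    rw [hasGap_leaf hv rfl] at hvi
    rw [hG]
    refine Or.inr ⟨huv, ?_⟩
    rcases hui with h1 | h1 <;> rcases hvi with h2 | h2
    · exact absurd (congrArg (fun d : T.Dart => d.fst) (hg.leaf_inj d e hu hv (h1.trans h2.symm))) huv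
    · exact ⟨d, e, hu, hv, Or.inl ⟨rfl, rfl⟩, h1.trans h2.symm⟩
    · exact ⟨e, d, hv, hu, Or.inr ⟨rfl, rfl⟩, h2.trans h1.symm⟩
    · exact absurd (congrArg (fun d : T.Dart => d.fst) (hg.leaf_symm_inj hu hv (h1.trans h2.symm))) huv
  refine ⟨x, fun i => i.elim K M, ?_, injective_realization hg hx hT, ?_, ?_, ?_, ?_, ?_, ?_⟩
  · rintro (_ | i) v
    · by_cases hv : IsLeaf T v
      · exact (hK v hv).le
      · exact (hK' v hv).le
    · exact hMle i v
  · intro u q hq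
    by_cases hu : IsLeaf T u
    · obtain ⟨d, rfl⟩ := exists_dart hT hg u
      obtain ⟨r, s, t, hr, hs, ht, h⟩ := cone_leaf hg hx hT hK hu hq
      refine ⟨some ⟨g d, hg.lt d⟩, some ⟨g d.symm, hg.lt _⟩, none, ?_, by simp, by simp,
        (hMeq _ _).2 (hself d), (hMeq _ _).2 (hself' d), hK _ hu, r, s, t, hr, hs, ht, h⟩
      simpa using hg.symm_ne d
    · obtain ⟨a, b, c, rfl, hb, hc, hab, hbc, r, s, t, hr, hs, ht, h⟩ :=
        hg.cone_interior hu (exists_dart hT hg u) (hinner hq)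
      refine ⟨some ⟨g a, hg.lt a⟩, some ⟨g b, hg.lt b⟩, some ⟨g c, hg.lt c⟩, ?_, ?_, ?_,
        (hMeq _ _).2 (hself a), (hMeq _ _).2 (hb ▸ hself b), (hMeq _ _).2 (hc ▸ hself c),
        r, s, t, hr, hs, ht, h⟩ <;>
      · simp only [Ne, Option.some.injEq, Fin.mk.injEq]
        omega
  · rintro (_ | i) (_ | j) hij
    · exact absurd rfl hij
    · obtain ⟨c, hc⟩ := hbase j
      exact linearIndependent_of_tri (c := c) (by rw [tri_swap]; exact neg_ne_zero.2 hc)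
    · obtain ⟨c, hc⟩ := hbase i
      exact linearIndependent_of_tri hc
    · have hij' : (i : ℕ) ≠ j := fun h => hij (congrArg some (Fin.ext h))
      exact linearIndependent_of_tri (c := mom (i + j + 1))
        (tri_mom_ne_zero hij' (by omega) (by omega))
  · intro u
    obtain ⟨d, rfl⟩ := exists_dart hT hg u
    by_cases hu : IsLeaf T d.fst
    · exact ⟨some ⟨g d, hg.lt d⟩, some ⟨g d.symm, hg.lt _⟩, none, (hMeq _ _).2 (hself d),
        (hMeq _ _).2 (hself' d), hK _ hu,
        fun y => eq_zero_of_inner (tri_base_pos hg hu).ne'⟩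
    · obtain ⟨e, he, hed, _⟩ := hg.third d d rfl hu
      obtain ⟨f, hf, hfd, hfe⟩ := hg.third d e he.symm hu
      refine ⟨some ⟨g d, hg.lt d⟩, some ⟨g e, hg.lt e⟩, some ⟨g f, hg.lt f⟩, (hMeq _ _).2 (hself d),
        (hMeq _ _).2 (he ▸ hself e), (hMeq _ _).2 (hf ▸ hself f),
        fun y => eq_zero_of_inner (tri_mom_ne_zero ?_ ?_ ?_)⟩
      · exact fun h => hed (hg.inj _ _ he h.symm)
      · exact fun h => hfd (hg.inj _ _ hf h.symm)
      · exact fun h => hfe (hg.inj _ _ (hf.trans he.symm) h.symm)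
  · intro u v huv
    constructor
    · intro h
      rcases (hG u v).1 h with h | ⟨_, d, e, hd, he, h, hde⟩
      · let d : T.Dart := ⟨(u, v), h⟩
        refine ⟨some ⟨g d, hg.lt d⟩, some ⟨g d.symm, hg.lt _⟩, ?_, (hMeq _ _).2 (hself d),
          (hMeq _ _).2 (hsnd d), (hMeq _ _).2 (hself' d), (hMeq _ _).2 (hself d.symm)⟩
        simpa using hg.symm_ne d
      · have h1 : HasGap g d.fst (g d) := hself d
        have h2 : HasGap g e.fst (g d) := hde ▸ hself' e
        rcases h with ⟨rfl, rfl⟩ | ⟨rfl, rfl⟩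
        · exact ⟨none, some ⟨g d, hg.lt d⟩, by simp, hK _ hd, hK _ he, (hMeq _ _).2 h1,
            (hMeq _ _).2 h2⟩
        · exact ⟨none, some ⟨g d, hg.lt d⟩, by simp, hK _ he, hK _ hd, (hMeq _ _).2 h2,
            (hMeq _ _).2 h1⟩
    · rintro ⟨i, j, hij, h1, h2, h3, h4⟩
      rcases i with _ | i <;> rcases j with _ | j
      · exact absurd rfl hij
      · exact hshare huv ((hKeq _).1 h1) ((hKeq _).1 h2) ((hMeq _ _).1 h3) ((hMeq _ _).1 h4)
      · exact hshare huv ((hKeq _).1 h3) ((hKeq _).1 h4) ((hMeq _ _).1 h1) ((hMeq _ _).1 h2)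
      · have hij' : (i : ℕ) ≠ j := fun h => hij (congrArg some (Fin.ext h))
        exact (hG u v).2 (Or.inl (adj_of_hasGap hg hx hT huv hij' ((hMeq _ _).1 h1)
          ((hMeq _ _).1 h2) ((hMeq _ _).1 h3) ((hMeq _ _).1 h4)))
  · rintro (_ | i) hi
    · exact absurd rfl hi
    · obtain ⟨d, e, hd, he, hdi, hei, hne⟩ := hends i i.2
      exact ⟨d.fst, e.fst, d.snd, hne, (hMeq _ _).2 (hdi ▸ hself d), (hMeq _ _).2 (hei ▸ hself' e),
        (hMeq _ _).2 (hdi ▸ hsnd d), hK _ hd, hK _ he,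
        fun h => hg.leaf_snd d hd ((hKeq _).1 h)⟩
  · obtain ⟨d, e, hd, he, hdi, hei, hne⟩ := hends 0 (by omega)
    -- The gaps of this leaf are `2` and `1`, so it is off the facet of gap `0` and not collinear
    -- with the two base vertices of that facet.
    obtain ⟨f, hf, hfi⟩ := hg.exists_leaf 2 (by omega)
    refine ⟨d.fst, e.fst, f.fst, d.snd, some ⟨0, by omega⟩, hne, hK _ hd, hK _ he, hK _ hf,
      fun h => hg.leaf_snd d hd ((hKeq _).1 h), (hMeq _ _).2 (hdi ▸ hself d),
      (hMeq _ _).2 (hei ▸ hself' e), fun h => ?_⟩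
    have h1 := (hMeq _ _).1 h
    rw [hasGap_leaf hf rfl] at h1
    have h2 := hg.leaf f hf
    simp only at h1
    omega

end Main

end HalinTreetope

end

theorem mainTheorem8 {V : Type*} [Finite V] (G : SimpleGraph V) (hG : HalinTreetope.IsHalin G) :
    ∃ P : Set (EuclideanSpace ℝ (Fin 3)),
      HalinTreetope.IsTreetope 3 P ∧ Nonempty (G ≃g HalinTreetope.polytopeGraph P) := by
  obtain ⟨hV, T, ρ, hT, hdeg, hρ, rfl⟩ := hG
  obtain ⟨n, g, hg, hnext⟩ :=
    HalinTreetope.exists_gapLabelling ρ hT hdeg hV (hρ.sameCycle hT)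
  obtain ⟨x, c, S⟩ := HalinTreetope.exists_facetSystem hT hg
    (G := T ⊔ HalinTreetope.leafCycle ρ) (by
      intro u v
      rw [SimpleGraph.sup_adj, HalinTreetope.leafCycle, SimpleGraph.fromRel_adj, hnext, hnext]
      refine or_congr_right (and_congr_right fun _ => ⟨?_, ?_⟩)
      · rintro (⟨d, e, hd, he, h1, h2, h⟩ | ⟨d, e, hd, he, h1, h2, h⟩)
        · exact ⟨d, e, hd, he, Or.inl ⟨h1, h2⟩, h⟩
        · exact ⟨d, e, hd, he, Or.inr ⟨h1, h2⟩, h⟩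
      · rintro ⟨d, e, hd, he, ⟨h1, h2⟩ | ⟨h1, h2⟩, h⟩
        · exact Or.inl ⟨d, e, hd, he, h1, h2, h⟩
        · exact Or.inr ⟨d, e, hd, he, h1, h2, h⟩)
  have hE : Module.finrank ℝ (EuclideanSpace ℝ (Fin 3)) = 3 := finrank_euclideanSpace_fin
  exact ⟨_, S.isTreetope hE, S.nonempty_iso hE⟩
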